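/- **Conventions.** A directed graph $\Gamma_+=(\Gamma^0,\Gamma^1_+,r,s)$ consists of a set of vertices, a set of edges, and range and source maps. Its underlying undirected graph $\Gamma$ has edge set $\Gamma^1=\Gamma^1_+\sqcup\{\overline e: e\in\Gamma^1_+\}$, with $\overline{\overline e}=e$, $r(\overline e)=s(e)$, $s(\overline e)=r(e)$. A path $d_1\cdots d_n$ in $\Gamma$ satisfies $s(d_i)=r(d_{i+1})$; it is reduced if $d_{i+1}\neq\overline{d_i}$ for all $i$. $\Gamma_+$ is a directed tree if between any two (possibly equal) vertices there is exactly one reduced path in $\Gamma$. A directed graph of groups $\mathcal G_+=(\Gamma_+,G)$ is a directed graph $\Gamma_+$ with groups $G_v$ ($v\in\Gamma^0$), groups $G_d=G_{\overline d}$ ($d\in\Gamma^1$) and monomorphisms $\alpha_d:G_d\to G_{r(d)}$ ($d\in\Gamma^1$); $\mathcal G$ denotes the underlying graph of groups. An isomorphism of directed graphs of groups is an isomorphism of directed graphs together with isomorphisms of corresponding vertex and edge groups that intertwine the monomorphisms; it is an isomorphism up to conjugation if they are intertwined only up to inner automorphisms of the vertex groups. The fundamental groupoid $F(\mathcal G)$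 is the groupoid with object set $\Gamma^0$ generated by the edges $d\in\Gamma^1$ (with range $r(d)$ and source $s(d)$) and the elements of the groups $G_v$ (with range and source $v$), subject to the relations of the groups $G_v$, $\overline d=d^{-1}$, and $\alpha_d(g)d=d\,\alpha_{\overline d}(g)$ for $d\in\Gamma^1$, $g\in G_d$. For $x\in\Gamma^0$, $\pi_1(\mathcal G,x)=xF(\mathcal G)x$ is the isotropy group at $x$. The directed Bass–Serre tree $X_{\mathcal G_+,x}$ has vertex set $\bigsqcup_{w\in\Gamma^0}xF(\mathcal G)w/G_w$, and has an edge from $\gamma'G_w$ to $\gamma G_v$ (exactly one) if and only if $\gamma^{-1}\gamma'\in G_v\,e\,G_w$ for some $e\in\Gamma^1_+$ with $r(e)=v$ and $s(e)=w$; $\pi_1(\mathcal G,x)$ acts on it by left multiplication. If a group $H$ acts on a directed graph $T_+$ by automorphisms, a directed graph of groups induced by the action is obtained as follows: take $\Gamma_+=H\backslash T_+$; choose a lift $v'$ of every vertex $v$ and a lift $e'$ of every edge $e\in\Gamma^1_+$, and put $\overline e{}'=\overline{e'}$; let $G_v$ and $G_e=G_{\overline e}$ be the stabilisers of $v'$ and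 $e'$ in $H$; for each $d\in\Gamma^1$ choose $g_d\in H$ with $g_d\cdot r(d')=r(d)'$, and put $\alpha_d(h)=g_d h g_d^{-1}$. **Theorem.** Let $\mathcal G_+=(\Gamma_+,G)$ be a directed graph of groups with $\Gamma$ connected, and let $x\in\Gamma^0$. 1. $X_{\mathcal G_+,x}$ is a directed tree, and the directed graph of groups induced by the action of $\pi_1(\mathcal G,x)$ on $X_{\mathcal G_+,x}$ is isomorphic to $\mathcal G_+$. Precisely: for every choice of lifts there is a choice of the elements $g_d$ for which it is isomorphic to $\mathcal G_+$, and for every choice of lifts and of the elements $g_d$ it is isomorphic to $\mathcal G_+$ up to conjugation. 2. Conversely, if a group $H$ acts on a directed tree $T_+$ and $\mathcal G_+$ is isomorphic to a directed graph of groups induced by this action (for some choice of lifts and elements $g_d$), then there are a group isomorphism $\varphi:\pi_1(\mathcal G,x)\to H$ and an isomorphism of directed graphs $\psi:X_{\mathcal G_+,x}\to T_+$ with $\psi(\gamma\cdot p)=\varphi(\gamma)\cdot\psi(p)$ for all $\gamma\in\pi_1(\mathcal G,x)$ and all vertices and edges $p$ of $X_{\mathcal G_+,x}$. -/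

import Mathlib

open CategoryTheory

universe u₁ u₂ u₃ u₄ u₅ u₆ u₇ u₈

set_option linter.checkUnivs false

namespace BassSerre

/-! ### Directed graphs, underlying undirected graphs, trees -/

/-- A directed graph: vertices `V`, edges `E`, range map `r`, source map `s`
(loops and multiple edges are allowed). -/
structure DirGraph where
  V : Type u₁
  E : Type u₂
  r : E → V
  s : E → V

namespace DirGraph

/-- The edges of the underlying undirected graph `Γ` of a directed graph `Γ₊`:
`(e, true)` is the edge `e` of `Γ₊` (these form the orientation), and `(e, false)` is its
reversal. -/
abbrev UEdge (Γ : DirGraph.{u₁, u₂}) : Type u₂ := Γ.E × Bool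

/-- The edge reversal of the underlying undirected graph. -/
def rev (Γ : DirGraph.{u₁, u₂}) (d : Γ.UEdge) : Γ.UEdge := (d.1, !d.2)

/-- The range map of the underlying undirected graph. -/
def ur (Γ : DirGraph.{u₁, u₂}) (d : Γ.UEdge) : Γ.V := cond d.2 (Γ.r d.1) (Γ.s d.1)

/-- The source map of the underlying undirected graph. -/
def us (Γ : DirGraph.{u₁, u₂}) (d : Γ.UEdge) : Γ.V := Γ.ur (Γ.rev d)

theorem rev_ne (Γ : DirGraph.{u₁, u₂}) (d : Γ.UEdge) : Γ.rev d ≠ d := by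
  rcases d with ⟨e, _ | _⟩ <;> simp [rev]

theorem rev_rev (Γ : DirGraph.{u₁, u₂}) (d : Γ.UEdge) : Γ.rev (Γ.rev d) = d := by
  simp [rev]

theorem ur_true (Γ : DirGraph.{u₁, u₂}) (e : Γ.E) : Γ.ur (e, true) = Γ.r e := rfl

theorem us_true (Γ : DirGraph.{u₁, u₂}) (e : Γ.E) : Γ.us (e, true) = Γ.s e := rfl

/-- `Γ.IsPath v w l`: the list `l = [d₁, …, dₙ]` is a path `d₁ d₂ ⋯ dₙ` in the underlying
undirected graph with range `v` and source `w`, that is, `v = r(d₁)`, `s(dᵢ) = r(dᵢ₊₁)` and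
`s(dₙ) = w`. -/
inductive IsPath (Γ : DirGraph.{u₁, u₂}) : Γ.V → Γ.V → List Γ.UEdge → Prop
  | nil (v : Γ.V) : IsPath Γ v v []
  | cons (d : Γ.UEdge) (w : Γ.V) (l : List Γ.UEdge) (h : IsPath Γ (Γ.us d) w l) :
      IsPath Γ (Γ.ur d) w (d :: l)

/-- A path is reduced if it contains no back-tracking `d (rev d)`. -/
def IsReduced (Γ : DirGraph.{u₁, u₂}) (l : List Γ.UEdge) : Prop :=
  l.IsChain (fun d d' => d' ≠ Γ.rev d)

/-- The underlying undirected graph is connected. -/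
def Connected (Γ : DirGraph.{u₁, u₂}) : Prop :=
  ∀ v w : Γ.V, ∃ l, Γ.IsPath v w l

/-- A directed tree: between any two vertices (equal ones included) there is exactly one reduced
path in the underlying undirected graph. -/
def IsTree (Γ : DirGraph.{u₁, u₂}) : Prop :=
  ∀ v w : Γ.V, ∃! l, Γ.IsPath v w l ∧ Γ.IsReduced l

/-- Isomorphisms of directed graphs. -/
structure Iso (Γ : DirGraph.{u₁, u₂}) (Δ : DirGraph.{u₃, u₄}) where
  v : Γ.V ≃ Δ.V
  e : Γ.E ≃ Δ.E
  r_comm : ∀ a : Γ.E, Δ.r (e a) = v (Γ.r a)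
  s_comm : ∀ a : Γ.E, Δ.s (e a) = v (Γ.s a)

/-- The isomorphism of underlying undirected graphs, on edges. -/
def Iso.ue {Γ : DirGraph.{u₁, u₂}} {Δ : DirGraph.{u₃, u₄}} (f : Iso Γ Δ) (d : Γ.UEdge) :
    Δ.UEdge := (f.e d.1, d.2)

theorem Iso.ur_comm {Γ : DirGraph.{u₁, u₂}} {Δ : DirGraph.{u₃, u₄}} (f : Iso Γ Δ)
    (d : Γ.UEdge) : f.v (Γ.ur d) = Δ.ur (f.ue d) := by
  rcases d with ⟨e, _ | _⟩
  · exact (f.s_comm e).symm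
  · exact (f.r_comm e).symm

end DirGraph

/-- An action of a group on a directed graph by automorphisms. -/
class GraphAction (H : Type u₃) [Group H] (T : DirGraph.{u₁, u₂}) where
  vAct : MulAction H T.V
  eAct : MulAction H T.E
  r_smul : ∀ (g : H) (e : T.E), T.r (g • e) = g • T.r e
  s_smul : ∀ (g : H) (e : T.E), T.s (g • e) = g • T.s e

attribute [reducible, instance] GraphAction.vAct GraphAction.eAct

/-! ### Directed graphs of groups -/

/-- A directed graph of groups: a directed graph `Γ₊`, a group `VG v` for every vertex, a group
`EG e` for every unoriented edge (so that `d` and `rev d` have the same group), and for every edge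
`d` of the underlying undirected graph a monomorphism `α_d` of the edge group into the vertex
group of the range of `d`. -/
structure DirGraphOfGroups where
  Γ : DirGraph.{u₁, u₂}
  VG : Γ.V → Type u₃
  EG : Γ.E → Type u₄
  vGroup : ∀ v, Group (VG v)
  eGroup : ∀ e, Group (EG e)
  α : ∀ d : Γ.UEdge, EG d.1 →* VG (Γ.ur d)
  α_injective : ∀ d, Function.Injective (α d)

attribute [instance] DirGraphOfGroups.vGroup DirGraphOfGroups.eGroup

namespace DirGraphOfGroups

/-- An isomorphism of the directed graphs together with isomorphisms of corresponding vertex and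
edge groups (no compatibility yet). -/
structure PreIso (𝒢 : DirGraphOfGroups.{u₁, u₂, u₃, u₄})
    (ℋ : DirGraphOfGroups.{u₅, u₆, u₇, u₈}) where
  graph : DirGraph.Iso 𝒢.Γ ℋ.Γ
  vIso : ∀ v, 𝒢.VG v ≃* ℋ.VG (graph.v v)
  eIso : ∀ e, 𝒢.EG e ≃* ℋ.EG (graph.e e)

/-- The isomorphism from the vertex group at the range of `d` to the vertex group at the range of
the image of `d`. -/
def PreIso.rIso {𝒢 : DirGraphOfGroups.{u₁, u₂, u₃, u₄}}
    {ℋ : DirGraphOfGroups.{u₅, u₆, u₇, u₈}} (f : PreIso 𝒢 ℋ) (d : 𝒢.Γ.UEdge) :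
    𝒢.VG (𝒢.Γ.ur d) ≃* ℋ.VG (ℋ.Γ.ur (f.graph.ue d)) :=
  (f.vIso (𝒢.Γ.ur d)).trans (MulEquiv.cast (M := ℋ.VG) (f.graph.ur_comm d))

/-- The isomorphisms preserve the monomorphisms. -/
def PreIso.Preserves {𝒢 : DirGraphOfGroups.{u₁, u₂, u₃, u₄}}
    {ℋ : DirGraphOfGroups.{u₅, u₆, u₇, u₈}} (f : PreIso 𝒢 ℋ) : Prop :=
  ∀ (d : 𝒢.Γ.UEdge) (h : 𝒢.EG d.1),
    f.rIso d (𝒢.α d h) = ℋ.α (f.graph.ue d) (f.eIso d.1 h)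

/-- The isomorphisms preserve the monomorphisms up to inner automorphisms of the vertex groups. -/
def PreIso.PreservesUpToConj {𝒢 : DirGraphOfGroups.{u₁, u₂, u₃, u₄}}
    {ℋ : DirGraphOfGroups.{u₅, u₆, u₇, u₈}} (f : PreIso 𝒢 ℋ) : Prop :=
  ∀ d : 𝒢.Γ.UEdge, ∃ c : ℋ.VG (ℋ.Γ.ur (f.graph.ue d)), ∀ h : 𝒢.EG d.1,
    f.rIso d (𝒢.α d h) = c * ℋ.α (f.graph.ue d) (f.eIso d.1 h) * c⁻¹

/-- Isomorphism of directed graphs of groups. -/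
def Isomorphic (𝒢 : DirGraphOfGroups.{u₁, u₂, u₃, u₄})
    (ℋ : DirGraphOfGroups.{u₅, u₆, u₇, u₈}) : Prop :=
  ∃ f : PreIso 𝒢 ℋ, f.Preserves

/-- Isomorphism of directed graphs of groups up to inner automorphisms of the vertex groups. -/
def IsomorphicUpToConj (𝒢 : DirGraphOfGroups.{u₁, u₂, u₃, u₄})
    (ℋ : DirGraphOfGroups.{u₅, u₆, u₇, u₈}) : Prop :=
  ∃ f : PreIso 𝒢 ℋ, f.PreservesUpToConj

end DirGraphOfGroups

/-! ### The directed graph of groups induced by an action -/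

section Induced

variable (H : Type u₃) [Group H] (T : DirGraph.{u₁, u₂}) [GraphAction H T]

/-- The quotient directed graph `H \ T`. -/
def quotientGraph : DirGraph.{u₁, u₂} where
  V := MulAction.orbitRel.Quotient H T.V
  E := MulAction.orbitRel.Quotient H T.E
  r := _root_.Quotient.map' T.r (by
    rintro _ e ⟨g, rfl⟩
    exact ⟨g, (GraphAction.r_smul g e).symm⟩)
  s := _root_.Quotient.map' T.s (by
    rintro _ e ⟨g, rfl⟩
    exact ⟨g, (GraphAction.s_smul g e).symm⟩)

/-- A choice of a lift to `T` of every vertex and every edge of the quotient graph. -/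
structure Lifts where
  v : (quotientGraph H T).V → T.V
  e : (quotientGraph H T).E → T.E
  v_spec : ∀ a, (_root_.Quotient.mk'' (v a) : MulAction.orbitRel.Quotient H T.V) = a
  e_spec : ∀ a, (_root_.Quotient.mk'' (e a) : MulAction.orbitRel.Quotient H T.E) = a

variable {H T}

/-- The lift of an edge of the underlying undirected graph of the quotient; the lift of a reversed
edge is the reversal of the lift. -/
def Lifts.ue (L : Lifts H T) (d : (quotientGraph H T).UEdge) : T.UEdge := (L.e d.1, d.2)

/-- A choice, for every edge `d` of the underlying undirected graph of the quotient, of an element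
of `H` moving the range of the lift of `d` to the lift of the range of `d`. -/
structure Transporters (L : Lifts H T) where
  g : (quotientGraph H T).UEdge → H
  spec : ∀ d, g d • T.ur (L.ue d) = L.v ((quotientGraph H T).ur d)

theorem smul_ur_eq {g : H} {d : T.UEdge} (hg : g • d.1 = d.1) : g • T.ur d = T.ur d := by
  rcases d with ⟨e, _ | _⟩
  · exact (GraphAction.s_smul g e).symm.trans (congrArg T.s hg)
  · exact (GraphAction.r_smul g e).symm.trans (congrArg T.r hg)

theorem Lifts.mk_ur (L : Lifts H T) (d : (quotientGraph H T).UEdge) :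
    (_root_.Quotient.mk'' (T.ur (L.ue d)) : MulAction.orbitRel.Quotient H T.V)
      = (quotientGraph H T).ur d := by
  rcases d with ⟨e, _ | _⟩
  · exact congrArg (quotientGraph H T).s (L.e_spec e)
  · exact congrArg (quotientGraph H T).r (L.e_spec e)

theorem Lifts.nonempty : Nonempty (Lifts H T) :=
  ⟨⟨_root_.Quotient.out, _root_.Quotient.out, fun a => _root_.Quotient.out_eq' a, fun a => _root_.Quotient.out_eq' a⟩⟩

theorem Transporters.nonempty (L : Lifts H T) : Nonempty (Transporters L) := by
  have h : ∀ d, ∃ g : H, g • T.ur (L.ue d) = L.v ((quotientGraph H T).ur d) := fun d =>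
    _root_.Quotient.exact' ((L.v_spec ((quotientGraph H T).ur d)).trans (L.mk_ur d).symm)
  choose g hg using h
  exact ⟨⟨g, hg⟩⟩

/-- The directed graph of groups induced by an action of `H` on `T`: vertex and edge groups are the
stabilisers of the chosen lifts, and `α_d` is `h ↦ g h g⁻¹` with `g` the chosen transporter. -/
def inducedGraphOfGroups (L : Lifts H T) (t : Transporters L) :
    DirGraphOfGroups.{u₁, u₂, u₃, u₃} where
  Γ := quotientGraph H T
  VG a := MulAction.stabilizer H (L.v a)
  EG a := MulAction.stabilizer H (L.e a)
  vGroup _ := inferInstance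
  eGroup _ := inferInstance
  α d :=
    { toFun := fun h => ⟨t.g d * h * (t.g d)⁻¹, by
        have h1 : (h : H) • T.ur (L.ue d) = T.ur (L.ue d) := smul_ur_eq h.2
        rw [MulAction.mem_stabilizer_iff, mul_smul, mul_smul, ← t.spec d, inv_smul_smul, h1]⟩
      map_one' := by ext; simp
      map_mul' := by intro a b; ext; simp [mul_assoc] }
  α_injective d := by
    intro a b hab
    have h1 : t.g d * a * (t.g d)⁻¹ = t.g d * b * (t.g d)⁻¹ := congrArg Subtype.val hab
    exact Subtype.ext (mul_left_cancel (mul_right_cancel h1))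

end Induced

/-! ### The fundamental groupoid and the fundamental group -/

namespace DirGraphOfGroups

variable (𝒢 : DirGraphOfGroups.{u₁, u₂, u₃, u₄})

/-- The generators of the fundamental groupoid. Arrows `v ⟶ w` stand for elements with range `v`
and source `w`, so that `γ ≫ γ'` is the product `γ γ'`, defined when the source of `γ` is the range
of `γ'`. -/
inductive Gen : 𝒢.Γ.V → 𝒢.Γ.V → Type (max u₁ u₂ u₃)
  | edge (d : 𝒢.Γ.UEdge) : Gen (𝒢.Γ.ur d) (𝒢.Γ.us d)
  | elt (v : 𝒢.Γ.V) (g : 𝒢.VG v) : Gen v v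

/-- The vertex set of `Γ`, as a type carrying the quiver of generators. -/
def GenVertex : Type u₁ := 𝒢.Γ.V

instance : Quiver.{max u₁ u₂ u₃} 𝒢.GenVertex where
  Hom v w := 𝒢.Gen v w

/-- The free groupoid on the generators. -/
abbrev FreeGpd : Type u₁ := Quiver.FreeGroupoid 𝒢.GenVertex

/-- A vertex of `Γ` as an object of the free groupoid. -/
def freeObj (v : 𝒢.Γ.V) : 𝒢.FreeGpd := (Quiver.FreeGroupoid.of 𝒢.GenVertex).obj v

/-- An edge of the underlying undirected graph as an arrow of the free groupoid. -/
def freeEdge (d : 𝒢.Γ.UEdge) : 𝒢.freeObj (𝒢.Γ.ur d) ⟶ 𝒢.freeObj (𝒢.Γ.us d) :=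
  (Quiver.FreeGroupoid.of 𝒢.GenVertex).map (Gen.edge d : 𝒢.Gen _ _)

/-- A vertex group element as an arrow of the free groupoid. -/
def freeElt {v : 𝒢.Γ.V} (g : 𝒢.VG v) : 𝒢.freeObj v ⟶ 𝒢.freeObj v :=
  (Quiver.FreeGroupoid.of 𝒢.GenVertex).map (Gen.elt v g : 𝒢.Gen _ _)

/-- The defining relations of the fundamental groupoid. -/
inductive FundRel : HomRel 𝒢.FreeGpd
  /-- the relations of the vertex groups -/
  | mul (v : 𝒢.Γ.V) (g h : 𝒢.VG v) :
      FundRel (𝒢.freeElt g ≫ 𝒢.freeElt h) (𝒢.freeElt (g * h))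
  /-- the reversal of an edge in the orientation is its inverse -/
  | rev_true (e : 𝒢.Γ.E) :
      FundRel (𝒢.freeEdge (e, false)) (Groupoid.inv (𝒢.freeEdge (e, true)))
  /-- the reversal of an edge not in the orientation is its inverse -/
  | rev_false (e : 𝒢.Γ.E) :
      FundRel (𝒢.freeEdge (e, true)) (Groupoid.inv (𝒢.freeEdge (e, false)))
  /-- the relation `α_d(h) d = d α_(rev d)(h)` -/
  | comm (d : 𝒢.Γ.UEdge) (h : 𝒢.EG d.1) :
      FundRel (𝒢.freeElt (𝒢.α d h) ≫ 𝒢.freeEdge d)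
        (𝒢.freeEdge d ≫ 𝒢.freeElt (𝒢.α (𝒢.Γ.rev d) h))

/-- The fundamental groupoid `F(𝒢)`. -/
abbrev FundGpd : Type u₁ := CategoryTheory.Quotient 𝒢.FundRel

/-- A vertex of `Γ` as an object of the fundamental groupoid. -/
def obj (v : 𝒢.Γ.V) : 𝒢.FundGpd := (CategoryTheory.Quotient.functor 𝒢.FundRel).obj (𝒢.freeObj v)

/-- The set `v F(𝒢) w` of elements of the fundamental groupoid with range `v` and source `w`. -/
abbrev Elem (v w : 𝒢.Γ.V) : Type (max u₁ u₂ u₃) := 𝒢.obj v ⟶ 𝒢.obj w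

/-- The element of `F(𝒢)` given by an edge of the underlying undirected graph. -/
def edge (d : 𝒢.Γ.UEdge) : 𝒢.Elem (𝒢.Γ.ur d) (𝒢.Γ.us d) :=
  (CategoryTheory.Quotient.functor 𝒢.FundRel).map (𝒢.freeEdge d)

/-- The element of `F(𝒢)` given by an edge of `Γ₊`. -/
def posEdge (e : 𝒢.Γ.E) : 𝒢.Elem (𝒢.Γ.r e) (𝒢.Γ.s e) := 𝒢.edge (e, true)

/-- The element of `F(𝒢)` given by a vertex group element. -/
def elt {v : 𝒢.Γ.V} (g : 𝒢.VG v) : 𝒢.Elem v v :=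
  (CategoryTheory.Quotient.functor 𝒢.FundRel).map (𝒢.freeElt g)

theorem elt_mul {v : 𝒢.Γ.V} (g h : 𝒢.VG v) : 𝒢.elt (g * h) = 𝒢.elt g ≫ 𝒢.elt h :=
  (CategoryTheory.Quotient.sound 𝒢.FundRel (FundRel.mul v g h)).symm.trans
    ((CategoryTheory.Quotient.functor 𝒢.FundRel).map_comp _ _)

theorem elt_one (v : 𝒢.Γ.V) : 𝒢.elt (1 : 𝒢.VG v) = 𝟙 (𝒢.obj v) := by
  have h := 𝒢.elt_mul (1 : 𝒢.VG v) 1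
  rw [mul_one] at h
  exact (cancel_epi (𝒢.elt (1 : 𝒢.VG v))).1 (h.symm.trans (Category.comp_id _).symm)

/-- The fundamental group `π₁(𝒢, x)`, the isotropy group of `F(𝒢)` at `x`. -/
abbrev π₁ (x : 𝒢.Γ.V) : Type (max u₁ u₂ u₃) := 𝒢.Elem x x

theorem π₁_mul (x : 𝒢.Γ.V) (a b : 𝒢.π₁ x) : a * b = a ≫ b := rfl

/-! ### The directed Bass–Serre tree -/

variable (x : 𝒢.Γ.V)

/-- `γ, γ' ∈ x F(𝒢) w` are equivalent if `γ' = γ g` for some `g ∈ G_w`. -/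
def cosetSetoid (w : 𝒢.Γ.V) : Setoid (𝒢.Elem x w) where
  r γ γ' := ∃ g : 𝒢.VG w, γ' = γ ≫ 𝒢.elt g
  iseqv :=
    { refl := fun γ => ⟨1, by rw [elt_one, Category.comp_id]⟩
      symm := by
        rintro γ _ ⟨g, rfl⟩
        exact ⟨g⁻¹, by rw [Category.assoc, ← elt_mul, mul_inv_cancel, elt_one, Category.comp_id]⟩
      trans := by
        rintro γ _ _ ⟨g, rfl⟩ ⟨h, rfl⟩
        exact ⟨g * h, by rw [elt_mul, Category.assoc]⟩ }

/-- The vertices (the disjoint union of the sets `x F(𝒢) w / G_w`, `w` a vertex of `Γ`) of the Bass–Serre tree. -/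
def BSVertex : Type (max u₁ u₂ u₃) := Σ w : 𝒢.Γ.V, _root_.Quotient (𝒢.cosetSetoid x w)

variable {x}

/-- The vertex `γ G_w`. -/
def coset {w : 𝒢.Γ.V} (γ : 𝒢.Elem x w) : 𝒢.BSVertex x := ⟨w, _root_.Quotient.mk _ γ⟩

/-- There is an edge in the orientation from `p` to `q`: `p = γ' G_w`, `q = γ G_v` and
`γ⁻¹ γ' ∈ G_v e G_w` for some edge `e` of `Γ₊` with range `v` and source `w`. -/
def BSAdj (p q : 𝒢.BSVertex x) : Prop :=
  ∃ (e : 𝒢.Γ.E) (γ' : 𝒢.Elem x (𝒢.Γ.s e)) (γ : 𝒢.Elem x (𝒢.Γ.r e)),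
    p = 𝒢.coset γ' ∧ q = 𝒢.coset γ ∧
      ∃ (g : 𝒢.VG (𝒢.Γ.r e)) (h : 𝒢.VG (𝒢.Γ.s e)),
        Groupoid.inv γ ≫ γ' = 𝒢.elt g ≫ 𝒢.posEdge e ≫ 𝒢.elt h

theorem edge_false (e : 𝒢.Γ.E) : 𝒢.edge (e, false) = Groupoid.inv (𝒢.posEdge e) :=
  CategoryTheory.Quotient.sound 𝒢.FundRel (FundRel.rev_true e)

theorem inv_edge_false (e : 𝒢.Γ.E) : Groupoid.inv (𝒢.edge (e, false)) = 𝒢.posEdge e := by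
  have h : Groupoid.inv (Groupoid.inv (𝒢.posEdge e)) = 𝒢.posEdge e := by
    simp [Groupoid.inv_eq_inv]
  exact (congrArg (fun a : 𝒢.Elem (𝒢.Γ.s e) (𝒢.Γ.r e) => Groupoid.inv a)
    (𝒢.edge_false e)).trans h

/-- Adjacency (from `p` to `q`) in the undirected Bass–Serre graph: `p = γ' G_w`, `q = γ G_v` and
`γ⁻¹ γ' ∈ G_v d G_w` for some edge `d` of the underlying undirected graph `Γ` with range `v` and
source `w`. -/
def BSUAdj (p q : 𝒢.BSVertex x) : Prop :=
  ∃ (d : 𝒢.Γ.UEdge) (γ' : 𝒢.Elem x (𝒢.Γ.us d)) (γ : 𝒢.Elem x (𝒢.Γ.ur d)),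
    p = 𝒢.coset γ' ∧ q = 𝒢.coset γ ∧
      ∃ (g : 𝒢.VG (𝒢.Γ.ur d)) (h : 𝒢.VG (𝒢.Γ.us d)),
        Groupoid.inv γ ≫ γ' = 𝒢.elt g ≫ 𝒢.edge d ≫ 𝒢.elt h

theorem elt_inv {v : 𝒢.Γ.V} (g : 𝒢.VG v) : Groupoid.inv (𝒢.elt g) = 𝒢.elt g⁻¹ := by
  rw [Groupoid.inv_eq_inv, IsIso.inv_eq_of_hom_inv_id]
  rw [← elt_mul, mul_inv_cancel, elt_one]

/-- The edges of the undirected Bass–Serre graph are the edges in the orientation and their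
reversals. -/
theorem bsUAdj_iff (p q : 𝒢.BSVertex x) : 𝒢.BSUAdj p q ↔ 𝒢.BSAdj p q ∨ 𝒢.BSAdj q p := by
  have key : ∀ {v w : 𝒢.Γ.V} (γ' : 𝒢.Elem x w) (γ : 𝒢.Elem x v) (g : 𝒢.VG v) (h : 𝒢.VG w)
      (a : 𝒢.Elem v w), Groupoid.inv γ ≫ γ' = 𝒢.elt g ≫ a ≫ 𝒢.elt h →
      Groupoid.inv γ' ≫ γ = 𝒢.elt h⁻¹ ≫ Groupoid.inv a ≫ 𝒢.elt g⁻¹ := by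
    intro v w γ' γ g h a H
    have H' := congrArg Groupoid.inv H
    simpa [← elt_inv, Groupoid.inv_eq_inv] using H'
  constructor
  · rintro ⟨⟨e, _ | _⟩, γ', γ, hp, hq, g, h, H⟩
    · refine Or.inr ⟨e, γ, γ', hq, hp, h⁻¹, g⁻¹, ?_⟩
      have H1 := key γ' γ g h (𝒢.edge (e, false)) H
      exact H1.trans (congrArg (fun a => 𝒢.elt h⁻¹ ≫ a ≫ 𝒢.elt g⁻¹) (𝒢.inv_edge_false e))
    · exact Or.inl ⟨e, γ', γ, hp, hq, g, h, H⟩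
  · rintro (⟨e, γ', γ, hp, hq, g, h, H⟩ | ⟨e, γ', γ, hq, hp, g, h, H⟩)
    · exact ⟨(e, true), γ', γ, hp, hq, g, h, H⟩
    · refine ⟨(e, false), γ, γ', hp, hq, h⁻¹, g⁻¹, ?_⟩
      rw [edge_false]
      exact key γ' γ g h (𝒢.posEdge e) H

variable (x)

/-- The directed Bass–Serre tree `X_{𝒢₊,x}`. An edge is a pair of vertices `(p, q)` (source, range)
such that there is an edge in the orientation from `p` to `q`. Its
underlying undirected graph is the undirected Bass–Serre graph, see `bsUAdj_iff`. -/
def bsTree : DirGraph.{max u₁ u₂ u₃, max u₁ u₂ u₃} where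
  V := 𝒢.BSVertex x
  E := {pq : 𝒢.BSVertex x × 𝒢.BSVertex x // 𝒢.BSAdj pq.1 pq.2}
  r a := a.1.2
  s a := a.1.1

variable {x}

/-- The action of `π₁(𝒢, x)` on vertices: `γ · γ' G_w = γ γ' G_w`. -/
def bsSmul (γ : 𝒢.π₁ x) (p : 𝒢.BSVertex x) : 𝒢.BSVertex x :=
  ⟨p.1, _root_.Quotient.map (fun γ' : 𝒢.Elem x p.1 => γ ≫ γ') (by
    rintro a _ ⟨g, rfl⟩
    exact ⟨g, (Category.assoc _ _ _).symm⟩) p.2⟩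

theorem bsSmul_coset (γ : 𝒢.π₁ x) {w : 𝒢.Γ.V} (γ' : 𝒢.Elem x w) :
    𝒢.bsSmul γ (𝒢.coset γ') = 𝒢.coset (γ ≫ γ') := rfl

theorem bsSmul_one (p : 𝒢.BSVertex x) : 𝒢.bsSmul 1 p = p := by
  obtain ⟨w, p⟩ := p
  induction p using _root_.Quotient.inductionOn with
  | h γ => exact (𝒢.bsSmul_coset 1 γ).trans (congrArg 𝒢.coset (Category.id_comp γ))

theorem bsSmul_mul (a b : 𝒢.π₁ x) (p : 𝒢.BSVertex x) :
    𝒢.bsSmul (a * b) p = 𝒢.bsSmul a (𝒢.bsSmul b p) := by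
  obtain ⟨w, p⟩ := p
  induction p using _root_.Quotient.inductionOn with
  | h γ => exact (𝒢.bsSmul_coset (a * b) γ).trans (congrArg 𝒢.coset (Category.assoc a b γ))

theorem BSAdj.smul {p q : 𝒢.BSVertex x} (a : 𝒢.π₁ x) (h : 𝒢.BSAdj p q) :
    𝒢.BSAdj (𝒢.bsSmul a p) (𝒢.bsSmul a q) := by
  obtain ⟨e, γ', γ, rfl, rfl, g, k, hgk⟩ := h
  refine ⟨e, a ≫ γ', a ≫ γ, rfl, rfl, g, k, ?_⟩
  rw [← hgk]
  simp [Groupoid.inv_eq_inv]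

/-- The action of `π₁(𝒢, x)` on the directed Bass–Serre tree. -/
instance bsAction : GraphAction (𝒢.π₁ x) (𝒢.bsTree x) where
  vAct :=
    { smul := fun a p => 𝒢.bsSmul a p
      one_smul := 𝒢.bsSmul_one
      mul_smul := 𝒢.bsSmul_mul }
  eAct :=
    { smul := fun a pq => ⟨(𝒢.bsSmul a pq.1.1, 𝒢.bsSmul a pq.1.2), BSAdj.smul 𝒢 a pq.2⟩
      one_smul := fun _ => Subtype.ext (Prod.ext (𝒢.bsSmul_one _) (𝒢.bsSmul_one _))
      mul_smul := fun a b _ =>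
        Subtype.ext (Prod.ext (𝒢.bsSmul_mul a b _) (𝒢.bsSmul_mul a b _)) }
  r_smul _ _ := rfl
  s_smul _ _ := rfl

end DirGraphOfGroups
end BassSerre

open BassSerre

namespace BassSerre

/-! ### The universal property of the fundamental groupoid -/

namespace DirGraphOfGroups

variable (𝒢 : DirGraphOfGroups.{u₁, u₂, u₃, u₄})

/-! No normal form for words in $F(\mathcal G)$ is used. Everything about $F(\mathcal G)$ is read
off from functors into concrete groupoids, built by the universal property (`LiftData`).

Two such functors do the work. Letting all vertex groups act freely on one large set, with matching
restrictions to the edge groups, shows that vertex groups embed in $F(\mathcal G)$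
(`elt_injective`). Attaching to the elements of $F(\mathcal G)$ with range $x$ an integer counter
that only a chosen coset $\gamma G_e$ changes gives a function on the vertices of the Bass–Serre
graph that jumps across exactly that coset (`exists_height`). Such functions rule out nontrivial
reduced closed paths and give uniqueness of reduced paths (`isTree_of_exists_height`). They also
show that an edge, although defined as a pair of vertices, determines its coset $\gamma G_e$
(`edgeCoset_eq_of_bsEdge_eq`). Connectedness holds because right multiplication by a generator moves
a coset along at most one edge.

Hence the stabilisers of $\gamma G_w$ and of the edge given by $\gamma G_e$ are the conjugates
$\gamma G_w\gamma^{-1}$ and $\gamma\alpha_e(G_e)\gamma^{-1}$, which identifies the induced graph of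
groups. Suitable transporters make the identification exact, and any other transporters change it by
vertex stabilisers, hence by inner automorphisms.

For the converse, sending an edge $e$ to $g_e g_{\bar e}^{-1}$ extends the inclusions of the
stabilisers to a multiplicative map $\Phi:F(\mathcal G)\to H$ (a `Development`). The map $\gamma
G_w\mapsto\Phi(\gamma)\cdot w'$ is equivariant and bijective on the edges at each vertex
(`bsEdge_eq_of_eImg_eq`, `exists_eImg_eq`). It therefore preserves reduced paths and lifts paths, so
over a tree it is an isomorphism; bijectivity of $\Phi$ on $\pi_1(\mathcal G,x)$ follows. -/

theorem comp_inv_of_comp_eq {C : Type u₅} [Groupoid.{u₆} C] {X Y : C} {a : X ⟶ X} {b : X ⟶ Y}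
    {c : Y ⟶ Y} (h : a ≫ b = b ≫ c) : c ≫ Groupoid.inv b = Groupoid.inv b ≫ a := by
  rw [Groupoid.inv_eq_inv, IsIso.comp_inv_eq, Category.assoc, IsIso.eq_inv_comp]
  exact h.symm

/-- The monomorphism of the edge group `G_e` into the vertex group at the range of `e`. -/
def αr (e : 𝒢.Γ.E) : 𝒢.EG e →* 𝒢.VG (𝒢.Γ.r e) := 𝒢.α (e, true)

/-- The monomorphism of the edge group `G_e` into the vertex group at the source of `e`. -/
def αs (e : 𝒢.Γ.E) : 𝒢.EG e →* 𝒢.VG (𝒢.Γ.s e) := 𝒢.α (e, false)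

/-- The data of a functor from the fundamental groupoid to a groupoid. -/
structure LiftData (C : Type u₅) [Groupoid.{u₆} C] where
  o : 𝒢.Γ.V → C
  a : ∀ v, 𝒢.VG v → (o v ⟶ o v)
  b : ∀ e, o (𝒢.Γ.r e) ⟶ o (𝒢.Γ.s e)
  a_mul : ∀ v g h, a v (g * h) = a v g ≫ a v h
  comm : ∀ e k, a _ (𝒢.αr e k) ≫ b e = b e ≫ a _ (𝒢.αs e k)

namespace LiftData

variable {𝒢} {C : Type u₅} [Groupoid.{u₆} C] (D : LiftData 𝒢 C)

/-- The image of an edge of the underlying undirected graph. -/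
def ub : ∀ d : 𝒢.Γ.UEdge, D.o (𝒢.Γ.ur d) ⟶ D.o (𝒢.Γ.us d)
  | (e, true) => D.b e
  | (e, false) => Groupoid.inv (D.b e)

/-- The images of the generators. -/
def gen : ∀ {v w : 𝒢.Γ.V}, 𝒢.Gen v w → (D.o v ⟶ D.o w)
  | _, _, .edge d => D.ub d
  | _, _, .elt v g => D.a v g

/-- The induced functor on the free groupoid. -/
def freeFunctor : 𝒢.FreeGpd ⥤ C :=
  Quiver.FreeGroupoid.lift (V := 𝒢.GenVertex)
    { obj := D.o
      map := fun f => D.gen f }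

theorem freeFunctor_gen {v w : 𝒢.Γ.V} (f : 𝒢.Gen v w) :
    D.freeFunctor.map ((Quiver.FreeGroupoid.of 𝒢.GenVertex).map f) = D.gen f :=
  -- A generator is a path of length one, which the lift sends to an identity followed by the image
  -- of the generator.
  Category.id_comp (D.gen f)

theorem freeFunctor_rel : ∀ (v w : 𝒢.FreeGpd) (f g : v ⟶ w), 𝒢.FundRel f g →
    D.freeFunctor.map f = D.freeFunctor.map g := by
  have hE : ∀ d, D.freeFunctor.map (𝒢.freeEdge d) = D.ub d := fun d => D.freeFunctor_gen (.edge d)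
  have hA : ∀ v (g : 𝒢.VG v), D.freeFunctor.map (𝒢.freeElt g) = D.a v g :=
    fun v g => D.freeFunctor_gen (.elt v g)
  have hinv : ∀ {v w : 𝒢.FreeGpd} (f : v ⟶ w),
      D.freeFunctor.map (Groupoid.inv f) = Groupoid.inv (D.freeFunctor.map f) := by
    intro v w f
    rw [Groupoid.inv_eq_inv, Groupoid.inv_eq_inv, Functor.map_inv]
  rintro _ _ _ _ (⟨v, g, h⟩ | e | e | ⟨⟨e, b⟩, k⟩)
  · exact (D.freeFunctor.map_comp _ _).trans
      ((congrArg₂ (· ≫ ·) (hA v g) (hA v h)).trans ((D.a_mul v g h).symm.trans (hA v (g * h)).symm))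
  · exact (hE (e, false)).trans (((hinv _).trans (congrArg Groupoid.inv (hE (e, true)))).symm)
  · refine (hE (e, true)).trans (((hinv _).trans (congrArg Groupoid.inv (hE (e, false)))).trans ?_).symm
    exact (by simp [Groupoid.inv_eq_inv] : Groupoid.inv (Groupoid.inv (D.b e)) = D.b e)
  · have h0 : D.a _ (𝒢.α (e, b) k) ≫ D.ub (e, b)
        = D.ub (e, b) ≫ D.a _ (𝒢.α (𝒢.Γ.rev (e, b)) k) := by
      cases b
      · have h := D.comm e k
        change D.a _ (𝒢.α (e, false) k) ≫ Groupoid.inv (D.b e)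
          = Groupoid.inv (D.b e) ≫ D.a _ (𝒢.α (e, true) k)
        exact comp_inv_of_comp_eq h
      · exact D.comm e k
    exact (D.freeFunctor.map_comp _ _).trans ((congrArg₂ (· ≫ ·) (hA _ _) (hE _)).trans
      (h0.trans ((D.freeFunctor.map_comp _ _).trans (congrArg₂ (· ≫ ·) (hE _) (hA _ _))).symm))

/-- The induced functor on the fundamental groupoid. -/
def functor : 𝒢.FundGpd ⥤ C :=
  CategoryTheory.Quotient.lift _ D.freeFunctor D.freeFunctor_rel

/-- The induced functor, on elements of the fundamental groupoid. -/
def map {v w : 𝒢.Γ.V} (γ : 𝒢.Elem v w) : D.o v ⟶ D.o w := D.functor.map γ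

theorem map_comp {u v w : 𝒢.Γ.V} (γ : 𝒢.Elem u v) (δ : 𝒢.Elem v w) :
    D.map (γ ≫ δ) = D.map γ ≫ D.map δ := D.functor.map_comp γ δ

theorem map_id (v : 𝒢.Γ.V) : D.map (𝟙 (𝒢.obj v)) = 𝟙 (D.o v) := D.functor.map_id (𝒢.obj v)

theorem map_elt {v : 𝒢.Γ.V} (g : 𝒢.VG v) : D.map (𝒢.elt g) = D.a v g :=
  D.freeFunctor_gen (.elt v g)

theorem map_posEdge (e : 𝒢.Γ.E) : D.map (𝒢.posEdge e) = D.b e :=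
  D.freeFunctor_gen (.edge (e, true))

end LiftData

variable {𝒢}

/-- Induction on elements of the fundamental groupoid by right multiplication by generators. -/
theorem Elem.induction_right {x : 𝒢.Γ.V} {P : ∀ w, 𝒢.Elem x w → Prop}
    (one : P x (𝟙 (𝒢.obj x)))
    (elt : ∀ w (γ : 𝒢.Elem x w) (g : 𝒢.VG w), P w γ → P w (γ ≫ 𝒢.elt g))
    (pos : ∀ e (γ : 𝒢.Elem x (𝒢.Γ.r e)), P _ γ → P _ (γ ≫ 𝒢.posEdge e))
    (neg : ∀ e (γ : 𝒢.Elem x (𝒢.Γ.s e)), P _ γ → P _ (γ ≫ Groupoid.inv (𝒢.posEdge e)))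
    {w : 𝒢.Γ.V} (γ : 𝒢.Elem x w) : P w γ := by
  have hpos : ∀ {v w : 𝒢.Γ.V} (f : 𝒢.Gen v w) (γ : 𝒢.Elem x v), P v γ →
      P w (γ ≫ (CategoryTheory.Quotient.functor 𝒢.FundRel).map
        ((Quiver.FreeGroupoid.of 𝒢.GenVertex).map f)) := by
    intro v w f γ hγ
    rcases f with ⟨e, _ | _⟩ | ⟨_, g⟩
    · have h := neg e _ hγ
      rw [← edge_false] at h
      exact h
    · exact pos e _ hγ
    · exact elt _ _ g hγ
  have hneg : ∀ {v w : 𝒢.Γ.V} (f : 𝒢.Gen v w) (γ : 𝒢.Elem x w), P w γ →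
      P v (γ ≫ Groupoid.inv ((CategoryTheory.Quotient.functor 𝒢.FundRel).map
        ((Quiver.FreeGroupoid.of 𝒢.GenVertex).map f))) := by
    intro v w f γ hγ
    rcases f with ⟨e, _ | _⟩ | ⟨_, g⟩
    · have h := pos e _ hγ
      rw [← inv_edge_false] at h
      exact h
    · exact neg e _ hγ
    · have h := elt _ _ g⁻¹ hγ
      rw [← elt_inv] at h
      exact h
  have hcons : ∀ {v w : 𝒢.Γ.V} (p : Quiver.Path (V := Quiver.Symmetrify 𝒢.GenVertex) x v)
      (f : 𝒢.Gen v w ⊕ 𝒢.Gen w v), P v (Quot.mk _ (Quot.mk _ p) : 𝒢.Elem x v) →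
      P w (Quot.mk _ (Quot.mk _ (Quiver.Path.cons (V := Quiver.Symmetrify 𝒢.GenVertex) p f)) :
        𝒢.Elem x w) := by
    intro v w p f ih
    rcases f with f | f
    · exact hpos f _ ih
    · exact hneg f _ ih
  have key : ∀ {w : 𝒢.Γ.V} (p : Quiver.Path (V := Quiver.Symmetrify 𝒢.GenVertex) x w),
      P w (Quot.mk _ (Quot.mk _ p) : 𝒢.Elem x w) := by
    intro w p
    induction p with
    | nil => exact one
    | cons p f ih => exact hcons p f ih
  -- An element is a doubly quotiented path in generators and formal inverses of generators, so
  -- induction on paths suffices.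
  obtain ⟨γ⟩ := γ
  obtain ⟨p⟩ := γ
  exact key p

end DirGraphOfGroups

/-! ### Two target groupoids -/

/-- The one-object groupoid of a group, with composition in the order of multiplication. -/
structure Deloop (H : Type u₅) : Type where

instance (H : Type u₅) [Group H] : Groupoid.{u₅} (Deloop H) where
  Hom _ _ := H
  id _ := (1 : H)
  comp a b := (a * b : H)
  id_comp a := one_mul (a : H)
  comp_id a := mul_one (a : H)
  assoc a b c := mul_assoc (a : H) b c
  inv a := (a⁻¹ : H)
  inv_comp a := inv_mul_cancel (a : H)
  comp_inv a := mul_inv_cancel (a : H)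

/-- The groupoid of types and bijections. -/
structure BijGpd : Type (u₅ + 1) where
  ty : Type u₅

instance : Groupoid.{u₅} BijGpd.{u₅} where
  Hom A B := A.ty ≃ B.ty
  id A := Equiv.refl A.ty
  comp a b := Equiv.trans a b
  inv a := Equiv.symm a
  inv_comp a := Equiv.symm_trans_self a
  comp_inv a := Equiv.self_trans_symm a

namespace DirGraphOfGroups

variable (𝒢 : DirGraphOfGroups.{u₁, u₂, u₃, u₄})

/-- The universal property with target a one-object groupoid. Relations are needed only for positive
edges, since reversed edges go to inverses. -/
theorem exists_map_to_group {H : Type u₅} [Group H] (a : ∀ v, 𝒢.VG v →* H) (b : 𝒢.Γ.E → H)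
    (comm : ∀ e k, a _ (𝒢.αr e k) * b e = b e * a _ (𝒢.αs e k)) :
    ∃ Φ : ∀ {v w : 𝒢.Γ.V}, 𝒢.Elem v w → H,
      (∀ {u v w : 𝒢.Γ.V} (γ : 𝒢.Elem u v) (δ : 𝒢.Elem v w), Φ (γ ≫ δ) = Φ γ * Φ δ) ∧
      (∀ {v : 𝒢.Γ.V} (g : 𝒢.VG v), Φ (𝒢.elt g) = a v g) ∧ ∀ e, Φ (𝒢.posEdge e) = b e := by
  let D : LiftData 𝒢 (Deloop H) :=
    { o := fun _ => ⟨⟩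
      a := fun v g => a v g
      b := b
      a_mul := fun v g h => (a v).map_mul g h
      comm := comm }
  exact ⟨fun γ => D.map γ, fun γ δ => D.map_comp γ δ, fun g => D.map_elt g, fun e => D.map_posEdge e⟩

end DirGraphOfGroups

/-! ### Vertex groups embed in the fundamental groupoid -/

/-- Cardinal arithmetic: a product with an infinite factor has the cardinality of the larger factor.
-/
theorem exists_prod_equiv_of_injective {A : Type u₅} {I : Type u₆} [Infinite I] [Nonempty A]
    {j : A → I} (hj : Function.Injective j) : Nonempty (A × I ≃ I) := by
  have h := Cardinal.mul_eq_right (a := Cardinal.lift.{u₆} (Cardinal.mk A))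
    (b := Cardinal.lift.{u₅} (Cardinal.mk I))
    (by simp) (Cardinal.lift_mk_le_lift_mk_of_injective hj) (by simp)
  rw [← Cardinal.mk_prod, ← Cardinal.mk_uLift] at h
  obtain ⟨f⟩ := Cardinal.eq.1 h
  exact ⟨f.trans Equiv.ulift⟩

/-- If `σ` turns `I` into a free `G`-set with `I` orbits and `I` is large, then `I` is a free
`N`-set with `I` orbits for every group `N` embedded in `G`. -/
theorem exists_restrict_free {G : Type u₅} {N : Type u₆} [Group G] [Group N] {α : N →* G}
    (hα : Function.Injective α) {I : Type u₇} [Infinite I] {j : G → I}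
    (hj : Function.Injective j) (σ : G × I ≃ I) :
    ∃ θ : N × I ≃ I, ∀ n m i, θ (n * m, i)
      = σ (α n * (σ.symm (θ (m, i))).1, (σ.symm (θ (m, i))).2) := by
  -- With a right transversal `S`, `G` is `N × S` as a left `N`-set, so `G × I` is `N × (S × I)`,
  -- and `S × I` has the size of `I`.
  obtain ⟨S, hS, h1⟩ := α.range.exists_isComplement_right 1
  have : Nonempty S := ⟨⟨1, h1⟩⟩
  obtain ⟨τ⟩ := exists_prod_equiv_of_injective
    (hj.comp (Subtype.val_injective : Function.Injective (Subtype.val : S → G)))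
  let κ : N × S ≃ G := ((MonoidHom.ofInjective hα).toEquiv.prodCongr (Equiv.refl S)).trans
    (Equiv.ofBijective _ hS)
  have hκ : ∀ n s, κ (n, s) = α n * s := fun n s => rfl
  refine ⟨((Equiv.refl N).prodCongr τ.symm).trans ((Equiv.prodAssoc N S I).symm.trans
    ((κ.prodCongr (Equiv.refl I)).trans σ)), fun n m i => ?_⟩
  simp [hκ, mul_assoc]

namespace DirGraphOfGroups

variable {𝒢 : DirGraphOfGroups.{u₁, u₂, u₃, u₄}}

/-- Every vertex group acts freely on a common set `I` with `I` many orbits. For an edge, the two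
restrictions to the edge group are again free with `I` many orbits, hence isomorphic, and an
isomorphism between them is an admissible image of the edge. The resulting map to `Equiv.Perm I` is
faithful on each vertex group. -/
theorem elt_injective (v : 𝒢.Γ.V) : Function.Injective (fun g : 𝒢.VG v => 𝒢.elt g) := by
  -- The factor `ℕ` makes `I` infinite even if all groups are finite; the other factor contains
  -- every vertex group.
  let I := ℕ × Σ v, 𝒢.VG v
  have : Nonempty (Σ v, 𝒢.VG v) := ⟨⟨v, 1⟩⟩
  have : Infinite I := inferInstance
  have hj : ∀ w, Function.Injective (fun g : 𝒢.VG w => ((0, ⟨w, g⟩) : I)) := by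
    intro w g h hgh
    simpa [I] using hgh
  have hσ : ∀ w, Nonempty (𝒢.VG w × I ≃ I) := fun w => exists_prod_equiv_of_injective (hj w)
  let σ := fun w => (hσ w).some
  choose θ hθ using fun d => exists_restrict_free (𝒢.α_injective d) (hj _) (σ (𝒢.Γ.ur d))
  let a : ∀ w, 𝒢.VG w →* Equiv.Perm I := fun w =>
    { toFun := fun g => (σ w).symm.trans
        (((Equiv.mulLeft g).prodCongr (Equiv.refl I)).trans (σ w))
      map_one' := by ext1 i; simp
      map_mul' := by
        intro g h
        ext1 i
        obtain ⟨⟨m, j⟩, rfl⟩ := (σ w).surjective i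
        simp [mul_assoc] }
  have ha : ∀ w g i, a w g i = σ w (g * ((σ w).symm i).1, ((σ w).symm i).2) := fun _ _ _ => rfl
  obtain ⟨Φ, -, hΦ, -⟩ := 𝒢.exists_map_to_group a
    (fun e => (θ (e, false)).symm.trans (θ (e, true))) (by
      intro e k
      ext1 i
      obtain ⟨⟨m, i⟩, rfl⟩ := (θ (e, false)).surjective i
      have h1 : θ (e, true) (k * m, i) = a _ (𝒢.αr e k) (θ (e, true) (m, i)) :=
        hθ (e, true) k m i
      have h2 : θ (e, false) (k * m, i) = a _ (𝒢.αs e k) (θ (e, false) (m, i)) :=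
        hθ (e, false) k m i
      rw [Equiv.Perm.mul_apply, Equiv.Perm.mul_apply, ← h2, Equiv.trans_apply, Equiv.trans_apply,
        Equiv.symm_apply_apply, Equiv.symm_apply_apply]
      exact h1.symm)
  intro g h hgh
  have h1 : a v g = a v h := by
    rw [← hΦ, ← hΦ]
    exact congrArg _ hgh
  -- Freeness: the group element is recovered from where it moves a point with group coordinate `1`.
  have h2 := congrArg (fun p : Equiv.Perm I => ((σ v).symm (p (σ v (1, (0, ⟨v, 1⟩))))).1) h1
  simpa [ha] using h2

/-! ### Height functions on the Bass–Serre tree -/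

-- The universal property for right actions: composition goes left to right, and each vertex of `Γ`
-- has its own set, as needed for right multiplication on `𝒢.Elem x w`.
variable (𝒢) in
theorem exists_map_to_bij (P : 𝒢.Γ.V → Type u₅) (a : ∀ v, 𝒢.VG v → (P v ≃ P v))
    (b : ∀ e, P (𝒢.Γ.r e) ≃ P (𝒢.Γ.s e))
    (a_mul : ∀ v g h, a v (g * h) = (a v g).trans (a v h))
    (comm : ∀ e k, (a _ (𝒢.αr e k)).trans (b e) = (b e).trans (a _ (𝒢.αs e k))) :
    ∃ Φ : ∀ {v w : 𝒢.Γ.V}, 𝒢.Elem v w → (P v ≃ P w),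
      (∀ {u v w : 𝒢.Γ.V} (γ : 𝒢.Elem u v) (δ : 𝒢.Elem v w), Φ (γ ≫ δ) = (Φ γ).trans (Φ δ)) ∧
      (∀ v, Φ (𝟙 (𝒢.obj v)) = Equiv.refl (P v)) ∧
      (∀ {v : 𝒢.Γ.V} (g : 𝒢.VG v), Φ (𝒢.elt g) = a v g) ∧ ∀ e, Φ (𝒢.posEdge e) = b e := by
  let D : LiftData 𝒢 BijGpd.{u₅} :=
    { o := fun v => ⟨P v⟩
      a := fun v g => a v g
      b := fun e => b e
      a_mul := a_mul
      comm := comm }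
  exact ⟨fun γ => D.map γ, fun γ δ => D.map_comp γ δ, fun v => D.map_id v,
    fun g => D.map_elt g, fun e => D.map_posEdge e⟩

/-- Elements of `x F(𝒢) r(e)` modulo the image of the edge group `G_e`. -/
def edgeSetoid (x : 𝒢.Γ.V) (e : 𝒢.Γ.E) : Setoid (𝒢.Elem x (𝒢.Γ.r e)) where
  r γ γ' := ∃ k : 𝒢.EG e, γ' = γ ≫ 𝒢.elt (𝒢.αr e k)
  iseqv :=
    { refl := fun γ => ⟨1, by rw [map_one, elt_one, Category.comp_id]⟩
      symm := by
        rintro γ _ ⟨k, rfl⟩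
        exact ⟨k⁻¹, by rw [Category.assoc, ← elt_mul, map_inv, mul_inv_cancel, elt_one,
          Category.comp_id]⟩
      trans := by
        rintro γ _ _ ⟨k, rfl⟩ ⟨l, rfl⟩
        exact ⟨k * l, by rw [map_mul, elt_mul, Category.assoc]⟩ }

/-- The disjoint union of the sets `x F(𝒢) r(e) / G_e`. -/
def EdgeCoset (x : 𝒢.Γ.V) : Type (max u₁ u₂ u₃) :=
  Σ e : 𝒢.Γ.E, _root_.Quotient (𝒢.edgeSetoid x e)

/-- The class `γ G_e`. -/
def edgeCoset {x : 𝒢.Γ.V} (e : 𝒢.Γ.E) (γ : 𝒢.Elem x (𝒢.Γ.r e)) : 𝒢.EdgeCoset x :=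
  ⟨e, _root_.Quotient.mk _ γ⟩

theorem edgeCoset_comp_elt {x : 𝒢.Γ.V} (e : 𝒢.Γ.E) (γ : 𝒢.Elem x (𝒢.Γ.r e)) (k : 𝒢.EG e) :
    𝒢.edgeCoset e (γ ≫ 𝒢.elt (𝒢.αr e k)) = 𝒢.edgeCoset e γ :=
  congrArg (Sigma.mk e) (_root_.Quotient.sound (s := 𝒢.edgeSetoid x e) ⟨k, rfl⟩).symm

theorem elt_comp_posEdge (e : 𝒢.Γ.E) (k : 𝒢.EG e) :
    𝒢.elt (𝒢.αr e k) ≫ 𝒢.posEdge e = 𝒢.posEdge e ≫ 𝒢.elt (𝒢.αs e k) := by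
  have h := CategoryTheory.Quotient.sound 𝒢.FundRel (FundRel.comm (e, true) k)
  exact ((CategoryTheory.Quotient.functor 𝒢.FundRel).map_comp _ _).symm.trans
    (h.trans ((CategoryTheory.Quotient.functor 𝒢.FundRel).map_comp _ _))

open Classical in
/-- For every edge class `a` there is an integer function on the vertices of the Bass–Serre tree
which jumps exactly across `a`. -/
theorem exists_height {x : 𝒢.Γ.V} (a : 𝒢.EdgeCoset x) :
    ∃ χ : 𝒢.BSVertex x → ℤ, ∀ e (γ : 𝒢.Elem x (𝒢.Γ.r e)),
      χ (𝒢.coset (γ ≫ 𝒢.posEdge e)) = χ (𝒢.coset γ) + if 𝒢.edgeCoset e γ = a then 1 else 0 := by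
  let c : ∀ e, 𝒢.Elem x (𝒢.Γ.r e) → ℤ := fun e γ => if 𝒢.edgeCoset e γ = a then 1 else 0
  -- Right multiplication with a counter: crossing `e` from `γ` adds `c e γ`, and vertex group
  -- elements leave the counter alone. This respects the edge relations because `c e` is constant on
  -- cosets of the edge group.
  obtain ⟨Φ, hcomp, hid, helt, hedge⟩ := 𝒢.exists_map_to_bij (fun w => 𝒢.Elem x w × ℤ)
    (fun w g =>
      { toFun := fun p => (p.1 ≫ 𝒢.elt g, p.2)
        invFun := fun p => (p.1 ≫ 𝒢.elt g⁻¹, p.2)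
        left_inv := fun p => Prod.ext (by
          change (p.1 ≫ 𝒢.elt g) ≫ 𝒢.elt g⁻¹ = p.1
          rw [Category.assoc, ← elt_mul, mul_inv_cancel, elt_one, Category.comp_id]) rfl
        right_inv := fun p => Prod.ext (by
          change (p.1 ≫ 𝒢.elt g⁻¹) ≫ 𝒢.elt g = p.1
          rw [Category.assoc, ← elt_mul, inv_mul_cancel, elt_one, Category.comp_id]) rfl })
    (fun e =>
      { toFun := fun p => (p.1 ≫ 𝒢.posEdge e, p.2 + c e p.1)
        invFun := fun p => (p.1 ≫ Groupoid.inv (𝒢.posEdge e),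
          p.2 - c e (p.1 ≫ Groupoid.inv (𝒢.posEdge e)))
        left_inv := fun p => by simp
        right_inv := fun p => by simp })
    (by
      intro v g h
      ext1 p
      exact Prod.ext (by simp [elt_mul]) rfl)
    (by
      intro e k
      ext1 p
      refine Prod.ext ?_ ?_
      · change (p.1 ≫ 𝒢.elt (𝒢.αr e k)) ≫ 𝒢.posEdge e
          = (p.1 ≫ 𝒢.posEdge e) ≫ 𝒢.elt (𝒢.αs e k)
        rw [Category.assoc, Category.assoc, elt_comp_posEdge]
      · change p.2 + c e (p.1 ≫ 𝒢.elt (𝒢.αr e k)) = p.2 + c e p.1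
        simp only [c, edgeCoset_comp_elt])
  have hinv : ∀ e, Φ (Groupoid.inv (𝒢.posEdge e)) = (Φ (𝒢.posEdge e)).symm := by
    intro e
    have h := hcomp (𝒢.posEdge e) (Groupoid.inv (𝒢.posEdge e))
    rw [Groupoid.comp_inv, hid] at h
    ext1 p
    obtain ⟨q, rfl⟩ := (Φ (𝒢.posEdge e)).surjective p
    rw [Equiv.symm_apply_apply]
    exact (congrArg (fun f => f q) h).symm
  -- The first coordinate of the orbit of `(𝟙, 0)` records the element itself, so the height of `γ`
  -- is the second coordinate.
  have hfst : ∀ {w : 𝒢.Γ.V} (γ : 𝒢.Elem x w), (Φ γ (𝟙 _, 0)).1 = γ := by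
    intro w γ
    refine Elem.induction_right (P := fun w γ => (Φ γ (𝟙 _, 0)).1 = γ) ?_ ?_ ?_ ?_ γ
    · rw [hid]; rfl
    · intro w γ g h
      rw [hcomp, helt]
      exact congrArg (· ≫ 𝒢.elt g) h
    · intro e γ h
      rw [hcomp, hedge]
      exact congrArg (· ≫ 𝒢.posEdge e) h
    · intro e γ h
      rw [hcomp, hinv, hedge]
      exact congrArg (· ≫ Groupoid.inv (𝒢.posEdge e)) h
  refine ⟨fun p => _root_.Quotient.liftOn p.2 (fun γ => (Φ γ (𝟙 _, 0)).2) ?_, ?_⟩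
  · rintro γ _ ⟨g, rfl⟩
    rw [hcomp, helt]
    rfl
  · intro e γ
    change (Φ (γ ≫ 𝒢.posEdge e) (𝟙 _, 0)).2 = (Φ γ (𝟙 _, 0)).2 + c e γ
    rw [hcomp, hedge]
    exact congrArg (fun δ => (Φ γ (𝟙 _, 0)).2 + c e δ) (hfst γ)

end DirGraphOfGroups

/-! ### Paths and trees -/

namespace DirGraph

variable {T : DirGraph.{u₁, u₂}}

theorem us_rev (d : T.UEdge) : T.us (T.rev d) = T.ur d := by
  rw [us, rev_rev]

theorem isPath_nil_iff {v w : T.V} : T.IsPath v w [] ↔ v = w := by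
  constructor
  · rintro ⟨⟩
    rfl
  · rintro rfl
    exact .nil v

theorem isPath_cons_iff {v w : T.V} {d : T.UEdge} {l : List T.UEdge} :
    T.IsPath v w (d :: l) ↔ v = T.ur d ∧ T.IsPath (T.us d) w l := by
  constructor
  · rintro ⟨⟩
    exact ⟨rfl, by assumption⟩
  · rintro ⟨rfl, h⟩
    exact .cons d w l h

theorem isPath_append_iff {v w : T.V} {l l' : List T.UEdge} :
    T.IsPath v w (l ++ l') ↔ ∃ u, T.IsPath v u l ∧ T.IsPath u w l' := by
  induction l generalizing v with
  | nil => simp [isPath_nil_iff]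
  | cons d l ih => simp [isPath_cons_iff, ih, and_assoc]

theorem IsPath.exists_reverse {v w : T.V} {l : List T.UEdge} (h : T.IsPath v w l) :
    ∃ l', T.IsPath w v l' := by
  induction h with
  | nil v => exact ⟨[], .nil v⟩
  | cons d w l _ ih =>
    obtain ⟨l', h'⟩ := ih
    refine ⟨l' ++ [T.rev d], isPath_append_iff.2 ⟨_, h', ?_⟩⟩
    exact isPath_cons_iff.2 ⟨rfl, isPath_nil_iff.2 (us_rev d)⟩

theorem IsPath.exists_reduced {v w : T.V} {l : List T.UEdge} (h : T.IsPath v w l) :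
    ∃ l', T.IsPath v w l' ∧ T.IsReduced l' := by
  induction h with
  | nil v => exact ⟨[], .nil v, .nil⟩
  | cons d w l _ ih =>
    obtain ⟨l', h', hr⟩ := ih
    rcases l' with _ | ⟨d', l'⟩
    · exact ⟨[d], .cons d w _ h', .singleton d⟩
    -- Prepending `d` to a reduced path either keeps it reduced or cancels its first edge.
    · by_cases hd : d' = T.rev d
      · subst hd
        refine ⟨l', ?_, hr.tail⟩
        rw [← us_rev d]
        exact (isPath_cons_iff.1 h').2
      · exact ⟨d :: d' :: l', .cons d w _ h', List.isChain_cons_cons.2 ⟨hd, hr⟩⟩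

theorem IsTree.connected (hT : T.IsTree) : T.Connected := fun v w =>
  (hT v w).exists.imp fun _ h => h.1

/-- In a tree, an edge is determined by its range and source. -/
theorem IsTree.edge_ext (hT : T.IsTree) {a b : T.E} (hr : T.r a = T.r b) (hs : T.s a = T.s b) :
    a = b := by
  have h : ∀ c : T.E, T.IsPath (T.r c) (T.s c) [(c, true)] ∧ T.IsReduced [(c, true)] := fun c =>
    ⟨.cons (c, true) _ _ (.nil _), .singleton _⟩
  have hb := h b
  rw [← hr, ← hs] at hb
  simpa using (hT _ _).unique (h a) hb

theorem IsTree.eq_nil (hT : T.IsTree) {v : T.V} {l : List T.UEdge} (h : T.IsPath v v l)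
    (hl : T.IsReduced l) : l = [] :=
  (hT v v).unique ⟨h, hl⟩ ⟨.nil v, .nil⟩

/-! ### Uniqueness of reduced paths from height functions -/

open Classical in
/-- A function on the vertices which increases by one along `d`, decreases by one along the
reversal of `d` and does not change along the other edges. -/
def IsHeight (χ : T.V → ℤ) (d : T.UEdge) : Prop :=
  ∀ d' : T.UEdge, χ (T.us d') = χ (T.ur d')
    + ((if d' = d then 1 else 0) - (if d' = T.rev d then 1 else 0))

theorem IsHeight.le {χ : T.V → ℤ} {d : T.UEdge} (hχ : IsHeight χ d) {v w : T.V}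
    {l : List T.UEdge} (h : T.IsPath v w l) (hl : T.rev d ∉ l) : χ v ≤ χ w := by
  induction h with
  | nil v => exact le_rfl
  | cons d' w l _ ih =>
    have h1 := hχ d'
    simp only [List.mem_cons, not_or] at hl
    rw [if_neg (c := d' = T.rev d) (fun h => hl.1 h.symm)] at h1
    have h2 := ih hl.2
    split_ifs at h1 <;> omega

theorem IsHeight.lt {χ : T.V → ℤ} {d : T.UEdge} (hχ : IsHeight χ d) {w : T.V}
    {l : List T.UEdge} (h : T.IsPath (T.us d) w l) (hl : T.rev d ∉ l) : χ (T.ur d) < χ w := by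
  have h1 := hχ d
  rw [if_pos rfl, if_neg (T.rev_ne d).symm] at h1
  have h2 := hχ.le h hl
  omega

/-- Between `d` and a later `rev d` lies a shorter reduced closed path. If it is empty, `d` is
followed immediately by its reversal. -/
theorem rev_notMem_of_closed {d : T.UEdge} {l : List T.UEdge}
    (hn : ∀ m : List T.UEdge, m.length < (d :: l).length → ∀ v, T.IsPath v v m → T.IsReduced m →
      m = [])
    {w : T.V} (h : T.IsPath (T.us d) w l) (hl : T.IsReduced (d :: l)) : T.rev d ∉ l := by
  intro hd
  obtain ⟨m, m', rfl⟩ := List.append_of_mem hd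
  obtain ⟨u, hm, hu⟩ := isPath_append_iff.1 h
  obtain ⟨rfl, -⟩ := isPath_cons_iff.1 hu
  have hm0 : m = [] := hn m (by simp) _ hm
    (List.IsChain.left_of_append (l₂ := T.rev d :: m') hl.tail)
  subst hm0
  exact (List.isChain_cons_cons.1 hl).1 rfl

/-- By induction on length, a reduced closed path starting with `d` never crosses `rev d`, so the
height of `d` would be strictly larger at its end than at its start. -/
theorem eq_nil_of_isHeight (H : ∀ d : T.UEdge, ∃ χ : T.V → ℤ, IsHeight χ d) (n : ℕ) :
    ∀ l : List T.UEdge, l.length < n → ∀ v, T.IsPath v v l → T.IsReduced l → l = [] := by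
  induction n with
  | zero => intro l hl; omega
  | succ n ih =>
    intro l hln v h hl
    rcases l with _ | ⟨d, l⟩
    · rfl
    · obtain ⟨rfl, h'⟩ := isPath_cons_iff.1 h
      obtain ⟨χ, hχ⟩ := H d
      have hd := rev_notMem_of_closed (fun m hm => ih m (by omega)) h' hl
      exact absurd (hχ.lt h' hd) (lt_irrefl _)

theorem reduced_unique_of_isHeight (H : ∀ d : T.UEdge, ∃ χ : T.V → ℤ, IsHeight χ d)
    {l : List T.UEdge} : ∀ {l' : List T.UEdge} {v w : T.V}, T.IsPath v w l → T.IsReduced l →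
      T.IsPath v w l' → T.IsReduced l' → l = l' := by
  have hnil : ∀ {v : T.V} {l : List T.UEdge}, T.IsPath v v l → T.IsReduced l → l = [] :=
    fun {v l} h hl => eq_nil_of_isHeight H _ l (Nat.lt_succ_self _) v h hl
  induction l with
  | nil =>
    intro l' v w h _ h' hl'
    obtain rfl := isPath_nil_iff.1 h
    exact (hnil h' hl').symm
  | cons d l ih =>
    intro l' v w h hl h' hl'
    obtain ⟨rfl, h1⟩ := isPath_cons_iff.1 h
    have hd := rev_notMem_of_closed (fun m _ v hm hr => hnil hm hr) h1 hl
    -- The heights of `d` and `rev d` have constant sum along a path. The first strictly increases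
    -- along `d :: l`, so the second decreases between the same endpoints, which a path avoiding `d`
    -- does not allow.
    have hmem : d ∈ l' := by
      by_contra hd'
      obtain ⟨χ, hχ⟩ := H (T.rev d)
      obtain ⟨χ', hχ'⟩ := H d
      have h2 := hχ.le h' (by rwa [rev_rev])
      have h3 := hχ'.lt h1 hd
      have h4 : ∀ u : T.V, ∀ v, ∀ m, T.IsPath u v m → χ u + χ' u = χ v + χ' v := by
        intro u v m hm
        induction hm with
        | nil v => rfl
        | cons d' w m _ ih =>
          have h5 := hχ d'
          have h6 := hχ' d'
          rw [rev_rev] at h5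
          omega
      have h5 := h4 _ _ _ h'
      omega
    obtain ⟨m, m', rfl⟩ := List.append_of_mem hmem
    obtain ⟨u, hm, hu⟩ := isPath_append_iff.1 h'
    obtain ⟨rfl, h2⟩ := isPath_cons_iff.1 hu
    -- The part of the second path before `d` is closed and reduced, so both paths start with `d`.
    obtain rfl : m = [] := hnil hm (List.IsChain.left_of_append (l₂ := d :: m') hl')
    exact congrArg (d :: ·) (ih h1 hl.tail h2 hl'.tail)

open Classical in
/-- A connected graph is a tree if every edge is detected by an integer function on the vertices. -/
theorem isTree_of_exists_height (hT : T.Connected)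
    (H : ∀ a : T.E, ∃ χ : T.V → ℤ, ∀ b : T.E, χ (T.s b) = χ (T.r b) + if b = a then 1 else 0) :
    T.IsTree := by
  have H' : ∀ d : T.UEdge, ∃ χ : T.V → ℤ, IsHeight χ d := by
    rintro ⟨a, c⟩
    obtain ⟨χ, hχ⟩ := H a
    -- The height of a reversed edge is the negative of the height of the edge.
    refine ⟨fun v => if c then χ v else - χ v, ?_⟩
    rintro ⟨b, c'⟩
    have h := hχ b
    cases c <;> cases c' <;> simp [us, ur, rev, h, add_comm]
  intro v w
  obtain ⟨l, hl⟩ := hT v w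
  obtain ⟨l, hl, hr⟩ := hl.exists_reduced
  exact ⟨l, ⟨hl, hr⟩, fun l' hl' => (reduced_unique_of_isHeight H' hl hr hl'.1 hl'.2).symm⟩

end DirGraph

/-! ### The Bass–Serre tree -/

namespace DirGraphOfGroups

variable {𝒢 : DirGraphOfGroups.{u₁, u₂, u₃, u₄}} {x : 𝒢.Γ.V}

theorem coset_eq_iff {w : 𝒢.Γ.V} {γ γ' : 𝒢.Elem x w} :
    𝒢.coset γ = 𝒢.coset γ' ↔ ∃ g : 𝒢.VG w, γ' = γ ≫ 𝒢.elt g := by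
  constructor
  · intro h
    exact _root_.Quotient.exact (s := 𝒢.cosetSetoid x w) (eq_of_heq (Sigma.mk.inj h).2)
  · intro h
    exact congrArg (Sigma.mk w) (_root_.Quotient.sound (s := 𝒢.cosetSetoid x w) h)

theorem coset_comp_elt {w : 𝒢.Γ.V} (γ : 𝒢.Elem x w) (g : 𝒢.VG w) :
    𝒢.coset (γ ≫ 𝒢.elt g) = 𝒢.coset γ :=
  (coset_eq_iff.2 ⟨g, rfl⟩).symm

/-- The coset `γ G_w` as a vertex of the Bass–Serre tree. -/
abbrev bsVtx {w : 𝒢.Γ.V} (γ : 𝒢.Elem x w) : (𝒢.bsTree x).V := 𝒢.coset γ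

theorem exists_bsVtx (p : (𝒢.bsTree x).V) : ∃ (w : 𝒢.Γ.V) (γ : 𝒢.Elem x w), 𝒢.bsVtx γ = p := by
  obtain ⟨w, ⟨γ⟩⟩ := p
  exact ⟨w, γ, rfl⟩

theorem edgeCoset_eq_iff {e : 𝒢.Γ.E} {γ γ' : 𝒢.Elem x (𝒢.Γ.r e)} :
    𝒢.edgeCoset e γ = 𝒢.edgeCoset e γ' ↔ ∃ k : 𝒢.EG e, γ' = γ ≫ 𝒢.elt (𝒢.αr e k) := by
  constructor
  · intro h
    exact _root_.Quotient.exact (s := 𝒢.edgeSetoid x e) (eq_of_heq (Sigma.mk.inj h).2)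
  · intro h
    exact congrArg (Sigma.mk e) (_root_.Quotient.sound (s := 𝒢.edgeSetoid x e) h)

/-- The edge from `γ e G_{s(e)}` to `γ G_{r(e)}`. -/
def bsEdge (e : 𝒢.Γ.E) (γ : 𝒢.Elem x (𝒢.Γ.r e)) : (𝒢.bsTree x).E :=
  ⟨(𝒢.coset (γ ≫ 𝒢.posEdge e), 𝒢.coset γ), e, γ ≫ 𝒢.posEdge e, γ, rfl, rfl, 1, 1, by
    rw [elt_one, elt_one, Category.id_comp, Category.comp_id, Groupoid.inv_eq_inv,
      IsIso.inv_hom_id_assoc]⟩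

theorem r_bsEdge (e : 𝒢.Γ.E) (γ : 𝒢.Elem x (𝒢.Γ.r e)) :
    (𝒢.bsTree x).r (𝒢.bsEdge e γ) = 𝒢.coset γ := rfl

theorem s_bsEdge (e : 𝒢.Γ.E) (γ : 𝒢.Elem x (𝒢.Γ.r e)) :
    (𝒢.bsTree x).s (𝒢.bsEdge e γ) = 𝒢.coset (γ ≫ 𝒢.posEdge e) := rfl

theorem bsTree_edge_ext {a b : (𝒢.bsTree x).E} (hr : (𝒢.bsTree x).r a = (𝒢.bsTree x).r b)
    (hs : (𝒢.bsTree x).s a = (𝒢.bsTree x).s b) : a = b :=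
  Subtype.ext (Prod.ext hs hr)

theorem exists_bsEdge (a : (𝒢.bsTree x).E) : ∃ e γ, 𝒢.bsEdge e γ = a := by
  obtain ⟨⟨p, q⟩, e, γ', γ, hp, hq, g, h, hgh⟩ := a
  refine ⟨e, γ ≫ 𝒢.elt g, bsTree_edge_ext ?_ ?_⟩
  · exact (coset_comp_elt γ g).trans hq.symm
  · refine Eq.trans ?_ hp.symm
    refine coset_eq_iff.2 ⟨h, ?_⟩
    rw [Groupoid.inv_eq_inv, IsIso.inv_comp_eq] at hgh
    rw [hgh]
    simp

theorem bsEdge_eq_of_edgeCoset_eq {e e' : 𝒢.Γ.E} {γ : 𝒢.Elem x (𝒢.Γ.r e)}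
    {γ' : 𝒢.Elem x (𝒢.Γ.r e')} (h : 𝒢.edgeCoset e γ = 𝒢.edgeCoset e' γ') :
    𝒢.bsEdge e γ = 𝒢.bsEdge e' γ' := by
  obtain rfl : e = e' := congrArg Sigma.fst h
  obtain ⟨k, rfl⟩ := edgeCoset_eq_iff.1 h
  refine bsTree_edge_ext (coset_comp_elt γ _).symm (coset_eq_iff.2 ⟨𝒢.αs e k, ?_⟩)
  rw [Category.assoc, Category.assoc, elt_comp_posEdge]

/-- The height of the class `γ G_e` differs by one at the two endpoints, whereas across any other
class it does not change. So the endpoints alone determine `e` and the coset. -/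
theorem edgeCoset_eq_of_bsEdge_eq {e e' : 𝒢.Γ.E} {γ : 𝒢.Elem x (𝒢.Γ.r e)}
    {γ' : 𝒢.Elem x (𝒢.Γ.r e')} (h : 𝒢.bsEdge e γ = 𝒢.bsEdge e' γ') :
    𝒢.edgeCoset e γ = 𝒢.edgeCoset e' γ' := by
  obtain ⟨χ, hχ⟩ := exists_height (𝒢.edgeCoset e γ)
  have h1 := hχ e γ
  have h2 := hχ e' γ'
  rw [← s_bsEdge, ← r_bsEdge] at h1 h2
  rw [h, h2, if_pos rfl] at h1
  by_contra hne
  rw [if_neg (Ne.symm hne)] at h1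
  omega

theorem bsTree_connected : (𝒢.bsTree x).Connected := by
  have key : ∀ {w : 𝒢.Γ.V} (γ : 𝒢.Elem x w),
      ∃ l, (𝒢.bsTree x).IsPath (𝒢.coset (𝟙 (𝒢.obj x) : 𝒢.Elem x x)) (𝒢.coset γ) l := by
    intro w γ
    refine Elem.induction_right (P := fun w γ => ∃ l, (𝒢.bsTree x).IsPath
      (𝒢.coset (𝟙 (𝒢.obj x) : 𝒢.Elem x x)) (𝒢.coset γ) l) ?_ ?_ ?_ ?_ γ
    · exact ⟨[], .nil _⟩
    · rintro w γ g ⟨l, hl⟩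
      refine ⟨l, ?_⟩
      rw [coset_comp_elt]
      exact hl
    · rintro e γ ⟨l, hl⟩
      exact ⟨l ++ [(𝒢.bsEdge e γ, true)], DirGraph.isPath_append_iff.2 ⟨_, hl,
        DirGraph.isPath_cons_iff.2 ⟨rfl, .nil _⟩⟩⟩
    · rintro e γ ⟨l, hl⟩
      refine ⟨l ++ [(𝒢.bsEdge e (γ ≫ Groupoid.inv (𝒢.posEdge e)), false)],
        DirGraph.isPath_append_iff.2 ⟨_, hl, DirGraph.isPath_cons_iff.2 ⟨?_, .nil _⟩⟩⟩
      change 𝒢.coset γ = 𝒢.coset ((γ ≫ Groupoid.inv (𝒢.posEdge e)) ≫ 𝒢.posEdge e)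
      rw [Category.assoc, Groupoid.inv_comp, Category.comp_id]
  intro p q
  obtain ⟨v, γ, rfl⟩ := exists_bsVtx p
  obtain ⟨w, δ, rfl⟩ := exists_bsVtx q
  obtain ⟨l, hl⟩ := key γ
  obtain ⟨l', hl'⟩ := hl.exists_reverse
  obtain ⟨m, hm⟩ := key δ
  exact ⟨l' ++ m, DirGraph.isPath_append_iff.2 ⟨_, hl', hm⟩⟩

-- The height of an edge class detects the corresponding edge because edges and edge classes
-- determine each other.
variable (𝒢 x) in
theorem bsTree_isTree : (𝒢.bsTree x).IsTree := by
  refine DirGraph.isTree_of_exists_height bsTree_connected fun a => ?_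
  obtain ⟨e, γ, rfl⟩ := exists_bsEdge a
  obtain ⟨χ, hχ⟩ := exists_height (𝒢.edgeCoset e γ)
  refine ⟨χ, fun b => ?_⟩
  obtain ⟨e', γ', rfl⟩ := exists_bsEdge b
  rw [r_bsEdge, s_bsEdge, hχ e' γ']
  congr 2
  exact propext ⟨bsEdge_eq_of_edgeCoset_eq, edgeCoset_eq_of_bsEdge_eq⟩

end DirGraphOfGroups

/-! ### Stabilisers and orbits in the Bass–Serre tree -/

namespace DirGraphOfGroups

variable {𝒢 : DirGraphOfGroups.{u₁, u₂, u₃, u₄}} {x : 𝒢.Γ.V}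

/-- The homomorphism `k ↦ δ k δ⁻¹` from `G_w` to the fundamental group, for `δ ∈ x F(𝒢) w`. -/
def conjElt {w : 𝒢.Γ.V} (δ : 𝒢.Elem x w) : 𝒢.VG w →* 𝒢.π₁ x :=
  MonoidHom.mk' (fun k => δ ≫ 𝒢.elt k ≫ Groupoid.inv δ) fun k l => by
    rw [π₁_mul, elt_mul]
    simp [Groupoid.inv_eq_inv]

theorem conjElt_apply {w : 𝒢.Γ.V} (δ : 𝒢.Elem x w) (k : 𝒢.VG w) :
    𝒢.conjElt δ k = δ ≫ 𝒢.elt k ≫ Groupoid.inv δ := rfl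

theorem conjElt_eq_iff {w : 𝒢.Γ.V} {δ : 𝒢.Elem x w} {k : 𝒢.VG w} {g : 𝒢.π₁ x} :
    𝒢.conjElt δ k = g ↔ g ≫ δ = δ ≫ 𝒢.elt k := by
  rw [conjElt_apply, Groupoid.inv_eq_inv, ← Category.assoc, IsIso.comp_inv_eq]
  exact eq_comm

theorem conjElt_injective {w : 𝒢.Γ.V} (δ : 𝒢.Elem x w) : Function.Injective (𝒢.conjElt δ) := by
  intro k l h
  have h1 := (conjElt_eq_iff.1 h).symm.trans (conjElt_eq_iff.1 (rfl : 𝒢.conjElt δ l = _))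
  exact elt_injective w ((cancel_epi δ).1 h1)

theorem conjElt_comp {w : 𝒢.Γ.V} (g : 𝒢.π₁ x) (δ : 𝒢.Elem x w) (k : 𝒢.VG w) :
    𝒢.conjElt (g ≫ δ) k = g * 𝒢.conjElt δ k * g⁻¹ := by
  refine conjElt_eq_iff.2 ?_
  change ((g ≫ 𝒢.conjElt δ k) ≫ Groupoid.inv g) ≫ g ≫ δ = _
  rw [conjElt_apply]
  simp [Groupoid.inv_eq_inv]

theorem smul_bsVtx {w : 𝒢.Γ.V} (g : 𝒢.π₁ x) (γ : 𝒢.Elem x w) :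
    g • 𝒢.bsVtx γ = 𝒢.bsVtx (g ≫ γ) := rfl

theorem smul_bsEdge (e : 𝒢.Γ.E) (g : 𝒢.π₁ x) (γ : 𝒢.Elem x (𝒢.Γ.r e)) :
    g • 𝒢.bsEdge e γ = 𝒢.bsEdge e (g ≫ γ) :=
  bsTree_edge_ext rfl (congrArg 𝒢.coset (Category.assoc g γ (𝒢.posEdge e)).symm)

/-- Fixing `δ G_w` means `g δ = δ k` for some `k` in `G_w`, that is, `g = δ k δ⁻¹`. -/
theorem range_conjElt {w : 𝒢.Γ.V} (δ : 𝒢.Elem x w) :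
    (𝒢.conjElt δ).range = MulAction.stabilizer (𝒢.π₁ x) (𝒢.bsVtx δ) := by
  ext g
  rw [MonoidHom.mem_range, MulAction.mem_stabilizer_iff, smul_bsVtx]
  exact (exists_congr fun k => conjElt_eq_iff).trans (coset_eq_iff.symm.trans eq_comm)

theorem range_conjElt_edge (e : 𝒢.Γ.E) (γ : 𝒢.Elem x (𝒢.Γ.r e)) :
    ((𝒢.conjElt γ).comp (𝒢.αr e)).range
      = MulAction.stabilizer (𝒢.π₁ x) (𝒢.bsEdge e γ : (𝒢.bsTree x).E) := by
  ext g
  rw [MonoidHom.mem_range, MulAction.mem_stabilizer_iff, smul_bsEdge]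
  refine Iff.trans (exists_congr fun k => conjElt_eq_iff) (edgeCoset_eq_iff.symm.trans ?_)
  exact ⟨fun h => (bsEdge_eq_of_edgeCoset_eq h).symm, fun h => (edgeCoset_eq_of_bsEdge_eq h).symm⟩

theorem exists_smul_eq_of_fst_eq {p q : (𝒢.bsTree x).V} (h : p.1 = q.1) :
    ∃ g : 𝒢.π₁ x, g • p = q := by
  obtain ⟨v, γ, rfl⟩ := exists_bsVtx p
  obtain ⟨w, δ, rfl⟩ := exists_bsVtx q
  obtain rfl : v = w := h
  refine ⟨δ ≫ Groupoid.inv γ, (smul_bsVtx _ γ).trans (congrArg 𝒢.bsVtx ?_)⟩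
  simp

/-! ### Representatives -/

/-- A representative of a vertex of the Bass–Serre tree. -/
noncomputable def vRep (p : (𝒢.bsTree x).V) : 𝒢.Elem x p.1 := _root_.Quotient.out p.2

theorem bsVtx_vRep (p : (𝒢.bsTree x).V) : 𝒢.bsVtx (vRep p) = p :=
  congrArg (Sigma.mk p.1) (_root_.Quotient.out_eq p.2)

/-- The edge of `Γ` below an edge of the Bass–Serre tree. -/
noncomputable def eTyp (a : (𝒢.bsTree x).E) : 𝒢.Γ.E := (exists_bsEdge a).choose

/-- A representative of an edge of the Bass–Serre tree. -/
noncomputable def eRep (a : (𝒢.bsTree x).E) : 𝒢.Elem x (𝒢.Γ.r (eTyp a)) :=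
  (exists_bsEdge a).choose_spec.choose

theorem bsEdge_eRep (a : (𝒢.bsTree x).E) : 𝒢.bsEdge (eTyp a) (eRep a) = a :=
  (exists_bsEdge a).choose_spec.choose_spec

/-- The chosen type does not depend on the choice, since an edge determines its edge class. -/
theorem eTyp_bsEdge (e : 𝒢.Γ.E) (γ : 𝒢.Elem x (𝒢.Γ.r e)) : eTyp (𝒢.bsEdge e γ) = e :=
  congrArg Sigma.fst (edgeCoset_eq_of_bsEdge_eq (bsEdge_eRep (𝒢.bsEdge e γ)))

theorem eTyp_smul (g : 𝒢.π₁ x) (a : (𝒢.bsTree x).E) : eTyp (g • a) = eTyp a := by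
  obtain ⟨e, γ, rfl⟩ := exists_bsEdge a
  rw [smul_bsEdge, eTyp_bsEdge, eTyp_bsEdge]

theorem exists_smul_eq_of_eTyp_eq {a b : (𝒢.bsTree x).E} (h : eTyp a = eTyp b) :
    ∃ g : 𝒢.π₁ x, g • a = b := by
  obtain ⟨e, γ, rfl⟩ := exists_bsEdge a
  obtain ⟨f, δ, rfl⟩ := exists_bsEdge b
  rw [eTyp_bsEdge, eTyp_bsEdge] at h
  subst h
  refine ⟨δ ≫ Groupoid.inv γ, (smul_bsEdge _ _ γ).trans (congrArg (𝒢.bsEdge e) ?_)⟩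
  simp

/-- The representative of an endpoint of an edge of the Bass–Serre tree. -/
noncomputable def uRep (a : (𝒢.bsTree x).E) : ∀ c : Bool, 𝒢.Elem x (𝒢.Γ.ur (eTyp a, c))
  | true => eRep a
  | false => eRep a ≫ 𝒢.posEdge (eTyp a)

theorem bsVtx_uRep (a : (𝒢.bsTree x).E) (c : Bool) :
    𝒢.bsVtx (uRep a c) = (𝒢.bsTree x).ur (a, c) := by
  cases c
  · exact congrArg (𝒢.bsTree x).s (bsEdge_eRep a)
  · exact congrArg (𝒢.bsTree x).r (bsEdge_eRep a)

/-- The stabiliser of a vertex of type `w` is isomorphic to `G_w`. -/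
noncomputable def vStab (p : (𝒢.bsTree x).V) : MulAction.stabilizer (𝒢.π₁ x) p ≃* 𝒢.VG p.1 :=
  ((MonoidHom.ofInjective (conjElt_injective (vRep p))).trans (MulEquiv.subgroupCongr
    ((range_conjElt (vRep p)).trans (congrArg (MulAction.stabilizer (𝒢.π₁ x)) (bsVtx_vRep p))))).symm

theorem conjElt_vStab (p : (𝒢.bsTree x).V) (h : MulAction.stabilizer (𝒢.π₁ x) p) :
    𝒢.conjElt (vRep p) (vStab p h) = h := by
  obtain ⟨k, rfl⟩ := (vStab p).symm.surjective h
  rw [MulEquiv.apply_symm_apply]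
  rfl

/-- The stabiliser of an edge of type `e` is isomorphic to `G_e`. -/
noncomputable def eStab (a : (𝒢.bsTree x).E) :
    MulAction.stabilizer (𝒢.π₁ x) a ≃* 𝒢.EG (eTyp a) :=
  ((MonoidHom.ofInjective (f := (𝒢.conjElt (eRep a)).comp (𝒢.αr (eTyp a)))
    ((conjElt_injective (eRep a)).comp (𝒢.α_injective (eTyp a, true)))).trans
    (MulEquiv.subgroupCongr ((range_conjElt_edge (eTyp a) (eRep a)).trans
      (congrArg (MulAction.stabilizer (𝒢.π₁ x)) (bsEdge_eRep a))))).symm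

/-- One isomorphism from the edge stabiliser to `G_e` serves both ends: at the range by
construction, at the source by the relation moving edge group elements across `e`. -/
theorem conjElt_eStab (a : (𝒢.bsTree x).E) (h : MulAction.stabilizer (𝒢.π₁ x) a) (c : Bool) :
    𝒢.conjElt (uRep a c) (𝒢.α (eTyp a, c) (eStab a h)) = h := by
  obtain ⟨k, rfl⟩ := (eStab a).symm.surjective h
  rw [MulEquiv.apply_symm_apply]
  cases c
  · refine Eq.trans ?_ (rfl : 𝒢.conjElt (eRep a) (𝒢.αr (eTyp a) k) = _)
    refine conjElt_eq_iff.2 ?_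
    change 𝒢.conjElt (eRep a) (𝒢.αr (eTyp a) k) ≫ eRep a ≫ 𝒢.posEdge (eTyp a)
      = (eRep a ≫ 𝒢.posEdge (eTyp a)) ≫ 𝒢.elt (𝒢.αs (eTyp a) k)
    rw [conjElt_apply, Category.assoc (eRep a) (𝒢.posEdge _), ← elt_comp_posEdge]
    simp [Groupoid.inv_eq_inv]
  · rfl

/-- The element `vRep q ρ⁻¹` carries the representative `ρ` to the chosen one, so conjugation by it
matches the two identifications with the vertex group. Leaving `w` free lets the cast be removed by
substitution. -/
theorem exists_transporter (q : (𝒢.bsTree x).V) (w : 𝒢.Γ.V) (hw : q.1 = w) (ρ : 𝒢.Elem x w) :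
    ∃ g : 𝒢.π₁ x, g • 𝒢.bsVtx ρ = q ∧
      ∀ (k : 𝒢.VG w) (y : MulAction.stabilizer (𝒢.π₁ x) q),
        (y : 𝒢.π₁ x) = g * 𝒢.conjElt ρ k * g⁻¹ →
        MulEquiv.cast (M := 𝒢.VG) hw (vStab q y) = k := by
  subst hw
  have h : (vRep q ≫ Groupoid.inv ρ) ≫ ρ = vRep q := by simp
  refine ⟨vRep q ≫ Groupoid.inv ρ, ?_, fun k y hy => ?_⟩
  · rw [smul_bsVtx, h, bsVtx_vRep]
  · refine conjElt_injective (vRep q) ((conjElt_vStab q y).trans (hy.trans ?_))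
    rw [← conjElt_comp, h]

/-! ### The graph of groups induced by the action on the Bass–Serre tree -/

section

variable (L : Lifts (𝒢.π₁ x) (𝒢.bsTree x))

theorem lifts_v_fst (p : (𝒢.bsTree x).V) :
    (L.v (_root_.Quotient.mk'' p : MulAction.orbitRel.Quotient (𝒢.π₁ x) (𝒢.bsTree x).V)).1
      = p.1 := by
  obtain ⟨g, hg⟩ := _root_.Quotient.exact' (L.v_spec (_root_.Quotient.mk'' p))
  exact (congrArg Sigma.fst hg).symm

theorem eTyp_lifts_e (a : (𝒢.bsTree x).E) :
    eTyp (L.e (_root_.Quotient.mk'' a : MulAction.orbitRel.Quotient (𝒢.π₁ x) (𝒢.bsTree x).E))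
      = eTyp a := by
  obtain ⟨g, hg⟩ := _root_.Quotient.exact' (L.e_spec (_root_.Quotient.mk'' a))
  exact (congrArg eTyp hg).symm.trans (eTyp_smul g a)

/-- Connectedness ensures that every vertex and edge of `Γ` occurs in the quotient of the Bass–Serre
tree. -/
theorem nonempty_elem (h𝒢 : 𝒢.Γ.Connected) (x w : 𝒢.Γ.V) : Nonempty (𝒢.Elem x w) := by
  obtain ⟨l, hl⟩ := h𝒢 x w
  induction hl with
  | nil v => exact ⟨𝟙 _⟩
  | cons d w l _ ih => exact ih.map fun γ => 𝒢.edge d ≫ γ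

/-- The isomorphism from the quotient of the Bass–Serre tree to `Γ₊`. -/
noncomputable def quotientIso (h𝒢 : 𝒢.Γ.Connected) :
    DirGraph.Iso (quotientGraph (𝒢.π₁ x) (𝒢.bsTree x)) 𝒢.Γ where
  v := Equiv.ofBijective (fun a => (L.v a).1) (by
    constructor
    · intro a b hab
      obtain ⟨g, hg⟩ := exists_smul_eq_of_fst_eq hab
      rw [← L.v_spec a, ← L.v_spec b, ← hg]
      exact (_root_.Quotient.sound (s := MulAction.orbitRel _ _) ⟨g, rfl⟩).symm
    · intro w
      obtain ⟨γ⟩ := nonempty_elem h𝒢 x w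
      exact ⟨_, lifts_v_fst L (𝒢.bsVtx γ)⟩)
  e := Equiv.ofBijective (fun a => eTyp (L.e a)) (by
    constructor
    · intro a b hab
      obtain ⟨g, hg⟩ := exists_smul_eq_of_eTyp_eq hab
      rw [← L.e_spec a, ← L.e_spec b, ← hg]
      exact (_root_.Quotient.sound (s := MulAction.orbitRel _ _) ⟨g, rfl⟩).symm
    · intro e
      obtain ⟨γ⟩ := nonempty_elem h𝒢 x (𝒢.Γ.r e)
      exact ⟨_, (eTyp_lifts_e L (𝒢.bsEdge e γ)).trans (eTyp_bsEdge e γ)⟩)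
  r_comm a := by
    have h := lifts_v_fst L ((𝒢.bsTree x).ur (L.ue (a, true)))
    rw [L.mk_ur] at h
    exact (congrArg Sigma.fst (bsVtx_uRep (L.e a) true)).trans h.symm
  s_comm a := by
    have h := lifts_v_fst L ((𝒢.bsTree x).ur (L.ue (a, false)))
    rw [L.mk_ur] at h
    exact (congrArg Sigma.fst (bsVtx_uRep (L.e a) false)).trans h.symm

/-- The isomorphism from the quotient of the Bass–Serre tree to `Γ₊`, together with the
isomorphisms from the stabilisers to the vertex and edge groups. -/
noncomputable def bsPreIso (t : Transporters L) (h𝒢 : 𝒢.Γ.Connected) :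
    PreIso (inducedGraphOfGroups L t) 𝒢 where
  graph := quotientIso L h𝒢
  vIso v := vStab (L.v v)
  eIso e := eStab (L.e e)

theorem exists_transporters_preserves (h𝒢 : 𝒢.Γ.Connected) :
    ∃ t : Transporters L, (bsPreIso L t h𝒢).Preserves := by
  choose g hg hk using fun d => exists_transporter (L.v ((quotientGraph _ _).ur d)) _
    ((quotientIso L h𝒢).ur_comm d) (uRep (L.e d.1) d.2)
  refine ⟨⟨g, fun d => ?_⟩, fun d h => hk d _ _ ?_⟩
  · rw [← hg d]
    exact congrArg (g d • ·) (bsVtx_uRep (L.e d.1) d.2).symm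
  · exact congrArg (fun y => g d * y * (g d)⁻¹) (conjElt_eStab (L.e d.1) h d.2).symm

/-- Two transporters for the same edge differ by an element of the stabiliser of the lifted vertex;
its image in the vertex group is the conjugating element. -/
theorem preservesUpToConj_of_preserves (h𝒢 : 𝒢.Γ.Connected) {t : Transporters L}
    (ht : (bsPreIso L t h𝒢).Preserves) (t' : Transporters L) :
    (bsPreIso L t' h𝒢).PreservesUpToConj := by
  intro d
  have hs : t'.g d * (t.g d)⁻¹ ∈ MulAction.stabilizer (𝒢.π₁ x)
      (L.v ((quotientGraph _ _).ur d)) := by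
    rw [MulAction.mem_stabilizer_iff, mul_smul, ← t.spec d, inv_smul_smul, t'.spec d, t.spec d]
  let s : MulAction.stabilizer (𝒢.π₁ x) (L.v ((quotientGraph _ _).ur d)) := ⟨_, hs⟩
  let R : MulAction.stabilizer (𝒢.π₁ x) (L.v ((quotientGraph _ _).ur d)) ≃*
      𝒢.VG (𝒢.Γ.ur ((quotientIso L h𝒢).ue d)) := (bsPreIso L t h𝒢).rIso d
  refine ⟨R s, fun h => ?_⟩
  let y : MulAction.stabilizer (𝒢.π₁ x) (L.v ((quotientGraph _ _).ur d)) :=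
    (inducedGraphOfGroups L t).α d h
  let y' : MulAction.stabilizer (𝒢.π₁ x) (L.v ((quotientGraph _ _).ur d)) :=
    (inducedGraphOfGroups L t').α d h
  have h1 : R y = 𝒢.α ((quotientIso L h𝒢).ue d) (eStab (L.e d.1) h) := ht d h
  have h2 : y' = s * y * s⁻¹ := by
    refine Subtype.ext ?_
    have key : ∀ {K : Type max u₁ u₂ u₃} [Group K] (a b z : K),
        a * z * a⁻¹ = a * b⁻¹ * (b * z * b⁻¹) * (a * b⁻¹)⁻¹ := by
      intro K _ a b z
      group
    exact key (t'.g d) (t.g d) (Subtype.val h)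
  change R y' = R s * 𝒢.α ((quotientIso L h𝒢).ue d) (eStab (L.e d.1) h) * (R s)⁻¹
  rw [← h1, h2, map_mul, map_mul, map_inv]

end

end DirGraphOfGroups

/-! ### Reconstruction of an action on a tree -/

namespace DirGraphOfGroups

variable {𝒢 : DirGraphOfGroups.{u₁, u₂, u₃, u₄}} {H : Type u₅} [Group H]
  {T : DirGraph.{u₆, u₇}} [GraphAction H T] {L : Lifts H T} {t : Transporters L}

/-- The homomorphisms from the vertex groups to `H`. -/
def PreIso.vMap (f : PreIso 𝒢 (inducedGraphOfGroups L t)) (v : 𝒢.Γ.V) : 𝒢.VG v →* H :=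
  MonoidHom.mk' (fun g => Subtype.val (f.vIso v g)) fun g h =>
    congrArg Subtype.val (map_mul (f.vIso v) g h)

/-- The homomorphisms from the edge groups to `H`. -/
def PreIso.eMap (f : PreIso 𝒢 (inducedGraphOfGroups L t)) (e : 𝒢.Γ.E) : 𝒢.EG e →* H :=
  MonoidHom.mk' (fun k => Subtype.val (f.eIso e k)) fun k l =>
    congrArg Subtype.val (map_mul (f.eIso e) k l)

theorem PreIso.vMap_injective (f : PreIso 𝒢 (inducedGraphOfGroups L t)) (v : 𝒢.Γ.V) :
    Function.Injective (f.vMap v) := fun _ _ h => (f.vIso v).injective (Subtype.ext h)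

theorem PreIso.exists_vMap_eq (f : PreIso 𝒢 (inducedGraphOfGroups L t)) {v : 𝒢.Γ.V} {h : H}
    (hh : h • L.v (f.graph.v v) = L.v (f.graph.v v)) : ∃ g, f.vMap v g = h := by
  obtain ⟨g, hg⟩ := (f.vIso v).surjective ⟨h, hh⟩
  exact ⟨g, congrArg Subtype.val hg⟩

theorem PreIso.exists_eMap_eq (f : PreIso 𝒢 (inducedGraphOfGroups L t)) {e : 𝒢.Γ.E} {h : H}
    (hh : h • L.e (f.graph.e e) = L.e (f.graph.e e)) : ∃ k, f.eMap e k = h := by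
  obtain ⟨g, hg⟩ := (f.eIso e).surjective ⟨h, hh⟩
  exact ⟨g, congrArg Subtype.val hg⟩

theorem PreIso.Preserves.vMap_α {f : PreIso 𝒢 (inducedGraphOfGroups L t)} (hf : f.Preserves)
    (d : 𝒢.Γ.UEdge) (k : 𝒢.EG d.1) :
    f.vMap _ (𝒢.α d k) = t.g (f.graph.ue d) * f.eMap d.1 k * (t.g (f.graph.ue d))⁻¹ := by
  have hcast : ∀ {a b : (quotientGraph H T).V} (hab : a = b) (y : MulAction.stabilizer H (L.v a)),
      (MulEquiv.cast (M := fun a => MulAction.stabilizer H (L.v a)) hab y).1 = y.1 := by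
    rintro a _ rfl y
    rfl
  exact (hcast (f.graph.ur_comm d) _).symm.trans (congrArg Subtype.val (hf d k))

/-- A multiplicative map from the fundamental groupoid to `H` extending the homomorphisms from the
vertex groups. -/
structure Development (f : PreIso 𝒢 (inducedGraphOfGroups L t)) where
  Φ : ∀ {v w : 𝒢.Γ.V}, 𝒢.Elem v w → H
  comp : ∀ {u v w : 𝒢.Γ.V} (γ : 𝒢.Elem u v) (δ : 𝒢.Elem v w), Φ (γ ≫ δ) = Φ γ * Φ δ
  elt : ∀ {v : 𝒢.Γ.V} (g : 𝒢.VG v), Φ (𝒢.elt g) = f.vMap v g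
  edge : ∀ e, Φ (𝒢.posEdge e) = t.g (f.graph.e e, true) * (t.g (f.graph.e e, false))⁻¹

/-- Both embeddings of the edge group are conjugations by transporters, so the quotient of the two
transporters intertwines them, as the edge relation demands. -/
theorem PreIso.Preserves.nonempty_development {f : PreIso 𝒢 (inducedGraphOfGroups L t)}
    (hf : f.Preserves) : Nonempty (Development f) := by
  obtain ⟨Φ, h1, h2, h3⟩ := 𝒢.exists_map_to_group f.vMap
    (fun e => t.g (f.graph.e e, true) * (t.g (f.graph.e e, false))⁻¹) (by
      intro e k
      have hr : f.vMap _ (𝒢.αr e k) = t.g (f.graph.e e, true) * f.eMap e k *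
        (t.g (f.graph.e e, true))⁻¹ := hf.vMap_α (e, true) k
      have hs : f.vMap _ (𝒢.αs e k) = t.g (f.graph.e e, false) * f.eMap e k *
        (t.g (f.graph.e e, false))⁻¹ := hf.vMap_α (e, false) k
      rw [hr, hs]
      group)
  exact ⟨⟨Φ, h1, h2, h3⟩⟩

theorem _root_.BassSerre.Lifts.v_eq_of_smul_eq (L : Lifts H T) {a b : (quotientGraph H T).V}
    {g h : H} (hab : g • L.v a = h • L.v b) : a = b := by
  rw [← L.v_spec a, ← L.v_spec b]
  refine _root_.Quotient.sound (s := MulAction.orbitRel _ _) ⟨g⁻¹ * h, ?_⟩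
  change (g⁻¹ * h) • L.v b = L.v a
  rw [mul_smul, ← hab, inv_smul_smul]

theorem _root_.BassSerre.Lifts.e_eq_of_smul_eq (L : Lifts H T) {a b : (quotientGraph H T).E}
    {g h : H} (hab : g • L.e a = h • L.e b) : a = b := by
  rw [← L.e_spec a, ← L.e_spec b]
  refine _root_.Quotient.sound (s := MulAction.orbitRel _ _) ⟨g⁻¹ * h, ?_⟩
  change (g⁻¹ * h) • L.e b = L.e a
  rw [mul_smul, ← hab, inv_smul_smul]

/-! ### The equivariant map from the Bass–Serre tree to `T` -/

namespace Development

variable {f : PreIso 𝒢 (inducedGraphOfGroups L t)} (D : Development f) {x : 𝒢.Γ.V}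

theorem id (v : 𝒢.Γ.V) : D.Φ (𝟙 (𝒢.obj v)) = 1 := by
  rw [← 𝒢.elt_one, D.elt, map_one]

theorem inv {v w : 𝒢.Γ.V} (γ : 𝒢.Elem v w) : D.Φ (Groupoid.inv γ) = (D.Φ γ)⁻¹ := by
  rw [eq_inv_iff_mul_eq_one, ← D.comp, Groupoid.inv_comp, D.id]

/-- `Φ` is injective on each coset because it embeds the vertex groups in `H`. -/
theorem eq_of_coset_eq {w : 𝒢.Γ.V} {γ γ' : 𝒢.Elem x w} (h : 𝒢.coset γ = 𝒢.coset γ')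
    (hΦ : D.Φ γ = D.Φ γ') : γ = γ' := by
  obtain ⟨g, rfl⟩ := coset_eq_iff.1 h
  rw [D.comp, D.elt, left_eq_mul] at hΦ
  rw [(map_eq_one_iff _ (f.vMap_injective w)).1 hΦ, elt_one, Category.comp_id]

theorem r_transport (e : 𝒢.Γ.E) :
    t.g (f.graph.e e, true) • T.r (L.e (f.graph.e e)) = L.v (f.graph.v (𝒢.Γ.r e)) :=
  (t.spec (f.graph.e e, true)).trans (congrArg L.v (f.graph.r_comm e))

theorem s_transport (e : 𝒢.Γ.E) :
    t.g (f.graph.e e, false) • T.s (L.e (f.graph.e e)) = L.v (f.graph.v (𝒢.Γ.s e)) :=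
  (t.spec (f.graph.e e, false)).trans (congrArg L.v (f.graph.s_comm e))

/-- The equivariant map from the Bass–Serre tree to `T`, on vertices. -/
def vFun (p : (𝒢.bsTree x).V) : T.V :=
  _root_.Quotient.liftOn p.2 (fun γ => D.Φ γ • L.v (f.graph.v p.1)) (by
    rintro γ _ ⟨g, rfl⟩
    have h : f.vMap p.1 g • L.v (f.graph.v p.1) = L.v (f.graph.v p.1) := (f.vIso p.1 g).2
    rw [D.comp, D.elt, mul_smul, h])

theorem vFun_bsVtx {w : 𝒢.Γ.V} (γ : 𝒢.Elem x w) :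
    D.vFun (𝒢.bsVtx γ) = D.Φ γ • L.v (f.graph.v w) := rfl

theorem vFun_smul (g : 𝒢.π₁ x) (p : (𝒢.bsTree x).V) : D.vFun (g • p) = D.Φ g • D.vFun p := by
  obtain ⟨w, γ, rfl⟩ := exists_bsVtx p
  rw [smul_bsVtx, vFun_bsVtx, vFun_bsVtx, D.comp, mul_smul]

/-- The edge of `T` corresponding to the edge from `γ e G_{s(e)}` to `γ G_{r(e)}`. -/
def eImg (e : 𝒢.Γ.E) (γ : 𝒢.Elem x (𝒢.Γ.r e)) : T.E :=
  (D.Φ γ * t.g (f.graph.e e, true)) • L.e (f.graph.e e)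

theorem r_eImg (e : 𝒢.Γ.E) (γ : 𝒢.Elem x (𝒢.Γ.r e)) :
    T.r (D.eImg e γ) = D.vFun (𝒢.bsVtx γ) := by
  rw [eImg, GraphAction.r_smul, mul_smul, r_transport, vFun_bsVtx]

theorem s_eImg (e : 𝒢.Γ.E) (γ : 𝒢.Elem x (𝒢.Γ.r e)) :
    T.s (D.eImg e γ) = D.vFun (𝒢.bsVtx (γ ≫ 𝒢.posEdge e)) := by
  rw [eImg, GraphAction.s_smul, vFun_bsVtx, D.comp, D.edge, ← s_transport, mul_smul, mul_smul,
    mul_smul, inv_smul_smul]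

/-- The equivariant map from the Bass–Serre tree to `T`, on edges. -/
noncomputable def eFun (a : (𝒢.bsTree x).E) : T.E := D.eImg (eTyp a) (eRep a)

theorem r_eFun (a : (𝒢.bsTree x).E) : T.r (D.eFun a) = D.vFun ((𝒢.bsTree x).r a) := by
  conv_rhs => rw [← bsEdge_eRep a]
  exact D.r_eImg _ _

theorem s_eFun (a : (𝒢.bsTree x).E) : T.s (D.eFun a) = D.vFun ((𝒢.bsTree x).s a) := by
  conv_rhs => rw [← bsEdge_eRep a]
  exact D.s_eImg _ _

/-- Injectivity on the edges at a vertex. Equal images differ by an edge stabiliser, so after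
changing `γ` by an element of `G_e`, which does not change the edge, the values of `Φ` agree; the
shared endpoint then forces equality of elements. -/
theorem bsEdge_eq_of_eImg_eq (hf : f.Preserves) {e e' : 𝒢.Γ.E} {γ : 𝒢.Elem x (𝒢.Γ.r e)}
    {γ' : 𝒢.Elem x (𝒢.Γ.r e')} (h : D.eImg e γ = D.eImg e' γ') (c : Bool)
    (hc : (𝒢.bsTree x).ur (𝒢.bsEdge e γ, c) = (𝒢.bsTree x).ur (𝒢.bsEdge e' γ', c)) :
    𝒢.bsEdge e γ = 𝒢.bsEdge e' γ' := by
  obtain rfl := f.graph.e.injective (L.e_eq_of_smul_eq h)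
  have h1 : ((D.Φ γ * t.g (f.graph.e e, true))⁻¹ * (D.Φ γ' * t.g (f.graph.e e, true))) •
      L.e (f.graph.e e) = L.e (f.graph.e e) := by
    rw [mul_smul, inv_smul_eq_iff]
    exact h.symm
  obtain ⟨k, hk⟩ := f.exists_eMap_eq h1
  have hr : f.vMap _ (𝒢.αr e k) = t.g (f.graph.e e, true) * f.eMap e k *
    (t.g (f.graph.e e, true))⁻¹ := hf.vMap_α (e, true) k
  have h2 : D.Φ (γ ≫ 𝒢.elt (𝒢.αr e k)) = D.Φ γ' := by
    rw [D.comp, D.elt, hr, hk]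
    group
  have h3 : 𝒢.bsEdge e (γ ≫ 𝒢.elt (𝒢.αr e k)) = 𝒢.bsEdge e γ :=
    bsEdge_eq_of_edgeCoset_eq (edgeCoset_comp_elt e γ k)
  rw [← h3] at hc ⊢
  cases c
  · have h4 := D.eq_of_coset_eq (γ := (γ ≫ 𝒢.elt (𝒢.αr e k)) ≫ 𝒢.posEdge e)
      (γ' := γ' ≫ 𝒢.posEdge e) hc (by rw [D.comp, h2, D.comp])
    rw [(cancel_mono (𝒢.posEdge e)).1 h4]
  · rw [D.eq_of_coset_eq (γ := γ ≫ 𝒢.elt (𝒢.αr e k)) (γ' := γ') hc h2]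

/-- Surjectivity onto the edges at an image vertex. Writing `b` as a translate of a lifted edge, the
translating element and `Φ γ` differ, up to a transporter, by a vertex stabiliser, which comes from
a vertex group element `k`; this corrects `γ`. -/
theorem exists_eImg_eq {w : 𝒢.Γ.V} (γ : 𝒢.Elem x w) (b : T.E) (c : Bool)
    (h : T.ur (b, c) = D.vFun (𝒢.bsVtx γ)) : ∃ e ρ, D.eImg (x := x) e ρ = b := by
  obtain ⟨e, he⟩ := f.graph.e.surjective
    (_root_.Quotient.mk'' b : MulAction.orbitRel.Quotient H T.E)
  obtain ⟨g, hg⟩ := _root_.Quotient.exact' (he.symm.trans (L.e_spec (f.graph.e e)).symm)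
  have hg' : g • L.e (f.graph.e e) = b := hg
  subst hg'
  clear hg he
  refine ⟨e, ?_⟩
  cases c
  · have h1 : (g * (t.g (f.graph.e e, false))⁻¹) • L.v (f.graph.v (𝒢.Γ.s e))
        = D.Φ γ • L.v (f.graph.v w) := by
      rw [← s_transport, mul_smul, inv_smul_smul, ← GraphAction.s_smul]
      exact h
    obtain rfl := f.graph.v.injective (L.v_eq_of_smul_eq h1)
    have h2 : ((D.Φ γ)⁻¹ * (g * (t.g (f.graph.e e, false))⁻¹)) • L.v (f.graph.v (𝒢.Γ.s e))
        = L.v (f.graph.v (𝒢.Γ.s e)) := by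
      rw [mul_smul, h1, inv_smul_smul]
    obtain ⟨k, hk⟩ := f.exists_vMap_eq h2
    refine ⟨γ ≫ 𝒢.elt k ≫ Groupoid.inv (𝒢.posEdge e), ?_⟩
    rw [eImg, D.comp, D.comp, D.inv, D.edge, D.elt, hk]
    congr 1
    group
  · have h1 : (g * (t.g (f.graph.e e, true))⁻¹) • L.v (f.graph.v (𝒢.Γ.r e))
        = D.Φ γ • L.v (f.graph.v w) := by
      rw [← r_transport, mul_smul, inv_smul_smul, ← GraphAction.r_smul]
      exact h
    obtain rfl := f.graph.v.injective (L.v_eq_of_smul_eq h1)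
    have h2 : ((D.Φ γ)⁻¹ * (g * (t.g (f.graph.e e, true))⁻¹)) • L.v (f.graph.v (𝒢.Γ.r e))
        = L.v (f.graph.v (𝒢.Γ.r e)) := by
      rw [mul_smul, h1, inv_smul_smul]
    obtain ⟨k, hk⟩ := f.exists_vMap_eq h2
    refine ⟨γ ≫ 𝒢.elt k, ?_⟩
    rw [eImg, D.comp, D.elt, hk]
    congr 1
    group

/-- The map from the Bass–Serre tree to `T`, on edges of the underlying undirected graph. -/
noncomputable def uFun (d : (𝒢.bsTree x).UEdge) : T.UEdge := (D.eFun d.1, d.2)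

theorem ur_uFun (d : (𝒢.bsTree x).UEdge) : T.ur (D.uFun d) = D.vFun ((𝒢.bsTree x).ur d) := by
  rcases d with ⟨a, _ | _⟩
  · exact D.s_eFun a
  · exact D.r_eFun a

theorem us_uFun (d : (𝒢.bsTree x).UEdge) : T.us (D.uFun d) = D.vFun ((𝒢.bsTree x).us d) :=
  D.ur_uFun ((𝒢.bsTree x).rev d)

theorem uFun_locally_injective (hf : f.Preserves) {d d' : (𝒢.bsTree x).UEdge}
    (h : D.uFun d = D.uFun d') (hd : (𝒢.bsTree x).ur d = (𝒢.bsTree x).ur d') : d = d' := by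
  obtain ⟨a, c⟩ := d
  obtain ⟨b, c'⟩ := d'
  obtain ⟨h1, rfl⟩ := Prod.mk.inj h
  have h2 := D.bsEdge_eq_of_eImg_eq hf h1 c (by rw [bsEdge_eRep, bsEdge_eRep]; exact hd)
  rw [bsEdge_eRep, bsEdge_eRep] at h2
  exact congrArg (·, c) h2

theorem isPath_map {p q : (𝒢.bsTree x).V} {l : List (𝒢.bsTree x).UEdge}
    (h : (𝒢.bsTree x).IsPath p q l) : T.IsPath (D.vFun p) (D.vFun q) (l.map D.uFun) := by
  induction h with
  | nil v => exact .nil _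
  | cons d w l _ ih =>
    rw [← us_uFun] at ih
    rw [← ur_uFun]
    exact .cons _ _ _ ih

/-- Backtracking in the image would give two edges at one vertex with the same image, hence
backtracking in the original path. -/
theorem isReduced_map (hf : f.Preserves) {p q : (𝒢.bsTree x).V}
    {l : List (𝒢.bsTree x).UEdge} (h : (𝒢.bsTree x).IsPath p q l)
    (hl : (𝒢.bsTree x).IsReduced l) : T.IsReduced (l.map D.uFun) := by
  induction h with
  | nil v => exact .nil
  | cons d w l h ih =>
    have ih' := ih hl.tail
    rcases l with _ | ⟨d', l⟩
    · exact .singleton _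
    · refine List.isChain_cons_cons.2 ⟨fun hd => ?_, ih'⟩
      refine (List.isChain_cons_cons.1 hl).1 ?_
      exact D.uFun_locally_injective hf (d' := (𝒢.bsTree x).rev d) hd
        (DirGraph.isPath_cons_iff.1 h).1.symm

/-- The reduced path between two vertices with the same image maps to a reduced closed path in a
tree, so it is empty. -/
theorem vFun_injective (hf : f.Preserves) (hT : T.IsTree) :
    Function.Injective (D.vFun (x := x)) := by
  intro p q hpq
  obtain ⟨l, ⟨hl, hr⟩, -⟩ := 𝒢.bsTree_isTree x p q
  have h1 := D.isPath_map hl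
  rw [hpq] at h1
  have h2 := hT.eq_nil h1 (D.isReduced_map hf hl hr)
  rw [List.map_eq_nil_iff] at h2
  subst h2
  exact DirGraph.isPath_nil_iff.1 hl

/-- Path lifting: the image is closed under passing along an edge, and `T` is connected. -/
theorem vFun_surjective (hT : T.IsTree) : Function.Surjective (D.vFun (x := x)) := by
  have key : ∀ {u v : T.V} {l : List T.UEdge}, T.IsPath u v l →
      (∃ p : (𝒢.bsTree x).V, D.vFun p = u) → ∃ p : (𝒢.bsTree x).V, D.vFun p = v := by
    intro u v l h
    induction h with
    | nil v => exact fun h => h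
    | cons d v l _ ih =>
      rintro ⟨p, hp⟩
      refine ih ?_
      obtain ⟨w, γ, rfl⟩ := exists_bsVtx p
      obtain ⟨b, c⟩ := d
      obtain ⟨e, ρ, rfl⟩ := D.exists_eImg_eq γ b c hp.symm
      cases c
      · exact ⟨_, (D.r_eImg e ρ).symm⟩
      · exact ⟨_, (D.s_eImg e ρ).symm⟩
  intro v
  obtain ⟨l, hl⟩ := hT.connected (D.vFun (𝒢.bsVtx (𝟙 (𝒢.obj x) : 𝒢.Elem x x))) v
  exact key hl ⟨_, rfl⟩

theorem eFun_surjective (hT : T.IsTree) : Function.Surjective (D.eFun (x := x)) := by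
  intro b
  obtain ⟨p, hp⟩ := D.vFun_surjective (x := x) hT (T.r b)
  obtain ⟨w, γ, rfl⟩ := exists_bsVtx p
  obtain ⟨e, ρ, rfl⟩ := D.exists_eImg_eq γ b true hp.symm
  refine ⟨𝒢.bsEdge e ρ, hT.edge_ext ?_ ?_⟩
  · rw [r_eFun, r_eImg, r_bsEdge]
  · rw [s_eFun, s_eImg, s_bsEdge]

/-- The isomorphism from the Bass–Serre tree to `T`. -/
noncomputable def iso (hf : f.Preserves) (hT : T.IsTree) : DirGraph.Iso (𝒢.bsTree x) T where
  v := Equiv.ofBijective D.vFun ⟨D.vFun_injective hf hT, D.vFun_surjective hT⟩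
  e := Equiv.ofBijective D.eFun ⟨fun a b h => bsTree_edge_ext
    (D.vFun_injective hf hT (by rw [← r_eFun, ← r_eFun, h]))
    (D.vFun_injective hf hT (by rw [← s_eFun, ← s_eFun, h])), D.eFun_surjective hT⟩
  r_comm := D.r_eFun
  s_comm := D.s_eFun

/-- The chosen representatives of edges need not be equivariant, but edges of a tree are determined
by their endpoints, where equivariance is known. -/
theorem eFun_smul (hT : T.IsTree) (g : 𝒢.π₁ x) (a : (𝒢.bsTree x).E) :
    D.eFun (g • a) = D.Φ g • D.eFun a := by
  refine hT.edge_ext ?_ ?_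
  · rw [r_eFun, GraphAction.r_smul, GraphAction.r_smul, vFun_smul, r_eFun]
  · rw [s_eFun, GraphAction.s_smul, GraphAction.s_smul, vFun_smul, s_eFun]

/-- A preimage of the translated base vertex has type `x`, so it gives `γ` in the fundamental group
with `Φ γ` equal to `h` up to the stabiliser of the base vertex, which lies in the image of `G_x`.
-/
theorem Φ_surjective (hT : T.IsTree) : Function.Surjective (fun g : 𝒢.π₁ x => D.Φ g) := by
  intro h
  obtain ⟨p, hp⟩ := D.vFun_surjective (x := x) hT (h • L.v (f.graph.v x))
  obtain ⟨w, γ, rfl⟩ := exists_bsVtx p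
  have hp' : D.Φ γ • L.v (f.graph.v w) = h • L.v (f.graph.v x) := hp
  obtain rfl := f.graph.v.injective (L.v_eq_of_smul_eq hp')
  obtain ⟨g, hg⟩ := f.exists_vMap_eq (h := (D.Φ γ)⁻¹ * h) (by
    rw [mul_smul, ← hp', inv_smul_smul])
  refine ⟨γ ≫ 𝒢.elt g, ?_⟩
  change D.Φ (γ ≫ 𝒢.elt g) = h
  rw [D.comp, D.elt, hg, mul_inv_cancel_left]

/-- The isomorphism from the fundamental group to `H`. -/
noncomputable def mulEquiv (hf : f.Preserves) (hT : T.IsTree) : 𝒢.π₁ x ≃* H :=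
  MulEquiv.ofBijective (MonoidHom.mk' (fun g : 𝒢.π₁ x => D.Φ g) fun g h => D.comp g h)
    ⟨by
      intro g h hgh
      -- Equal values of `Φ` send the base vertex to the same place, so injectivity on vertices puts
      -- both elements in one coset of `G_x`.
      refine D.eq_of_coset_eq (D.vFun_injective hf hT ?_) hgh
      exact congrArg (· • L.v (f.graph.v x)) hgh, D.Φ_surjective hT⟩

end Development

end DirGraphOfGroups

end BassSerre

theorem mainTheorem8 (𝒢 : DirGraphOfGroups.{u₁, u₂, u₃, u₄}) (x : 𝒢.Γ.V)
    (h𝒢 : 𝒢.Γ.Connected) :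
    ((𝒢.bsTree x).IsTree ∧
      (∀ L : Lifts (𝒢.π₁ x) (𝒢.bsTree x), ∃ t : Transporters L,
        (inducedGraphOfGroups L t).Isomorphic 𝒢) ∧
      (∀ (L : Lifts (𝒢.π₁ x) (𝒢.bsTree x)) (t : Transporters L),
        (inducedGraphOfGroups L t).IsomorphicUpToConj 𝒢)) ∧
    (∀ (H : Type u₅) [Group H] (T : DirGraph.{u₆, u₇}) [GraphAction H T], T.IsTree →
      ∀ (L : Lifts H T) (t : Transporters L), 𝒢.Isomorphic (inducedGraphOfGroups L t) →
        ∃ (φ : 𝒢.π₁ x ≃* H) (ψ : DirGraph.Iso (𝒢.bsTree x) T),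
          (∀ (γ : 𝒢.π₁ x) (p : (𝒢.bsTree x).V), ψ.v (γ • p) = φ γ • ψ.v p) ∧
          (∀ (γ : 𝒢.π₁ x) (a : (𝒢.bsTree x).E), ψ.e (γ • a) = φ γ • ψ.e a)) := by
  refine ⟨⟨𝒢.bsTree_isTree x, fun L => ?_, fun L t => ?_⟩, ?_⟩
  · obtain ⟨t, ht⟩ := DirGraphOfGroups.exists_transporters_preserves L h𝒢
    exact ⟨t, _, ht⟩
  · obtain ⟨t', ht'⟩ := DirGraphOfGroups.exists_transporters_preserves L h𝒢
    exact ⟨_, DirGraphOfGroups.preservesUpToConj_of_preserves L h𝒢 ht' t⟩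
  · rintro H _ T _ hT L t ⟨f, hf⟩
    obtain ⟨D⟩ := hf.nonempty_development
    exact ⟨D.mulEquiv hf hT, D.iso hf hT, D.vFun_smul, D.eFun_smul hT⟩
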